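/- Let $N\ge 1$. For real-valued $u\in W^{1,2}(\mathbb{R}^N)$ with $\|xu\|_2<\infty$, where $\|\cdot\|_2$ is the norm of $L^2(\mathbb{R}^N)$ and $\nabla u$ the weak gradient, let $$\delta_1(u)=\|\nabla u\|_2\,\|xu\|_2-\frac N2\,\|u\|_2^2 .$$ Then for all such $u$ $$\delta_1(u)\ \ge\ \inf_{c\in\mathbb{R},\ \alpha>0}\ \big\|u-ce^{-\alpha|x|^2}\big\|_2^2$$ and $$\delta_1(u)\ \ge\ \frac12\,\inf\Big\{\big\|u-ce^{-\alpha|x|^2}\big\|_2^2\ :\ c\in\mathbb{R},\ \alpha>0,\ \|u\|_2=\big\|ce^{-\alpha|x|^2}\big\|_2\Big\}.$$ Both inequalities are sharp: the constants $1$ and $\frac12$ cannot be replaced by larger ones, and equality holds in both inequalities for $u(x)=x_1e^{-|x|^2/2}$, for which both infima are positive. -/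

import Mathlib

open MeasureTheory
open scoped ContDiff

noncomputable section

/-- `g` is the weak (distributional) gradient of the real function `u` on `ℝ^N`: both are locally
integrable and `∫ u ∂ᵢφ = - ∫ gᵢ φ` for every test function `φ ∈ C_c^∞(ℝ^N)` and every `i`. -/
structure HasWeakGradient {N : ℕ} (u : EuclideanSpace ℝ (Fin N) → ℝ)
    (g : EuclideanSpace ℝ (Fin N) → EuclideanSpace ℝ (Fin N)) : Prop where
  locallyIntegrable : LocallyIntegrable u volume
  locallyIntegrable_grad : LocallyIntegrable g volume
  integral_eq : ∀ φ : EuclideanSpace ℝ (Fin N) → ℝ, ContDiff ℝ ∞ φ → HasCompactSupport φ →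
    ∀ i : Fin N,
      ∫ x, u x * fderiv ℝ φ x (EuclideanSpace.single i 1) = - ∫ x, g x i * φ x

/-- The weak gradient is unique up to null sets, so that the choice in `weakGradient` below
does not matter. -/
theorem HasWeakGradient.ae_eq {N : ℕ} {u : EuclideanSpace ℝ (Fin N) → ℝ}
    {g g' : EuclideanSpace ℝ (Fin N) → EuclideanSpace ℝ (Fin N)}
    (h : HasWeakGradient u g) (h' : HasWeakGradient u g') : g =ᵐ[volume] g' := by
  have key : ∀ i : Fin N, (fun x => g x i) =ᵐ[volume] fun x => g' x i := by
    intro i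
    have loc : ∀ f : EuclideanSpace ℝ (Fin N) → EuclideanSpace ℝ (Fin N),
        LocallyIntegrable f volume → LocallyIntegrable (fun x => f x i) volume := by
      intro f hf x
      obtain ⟨s, hs, hi⟩ := hf x
      exact ⟨s, hs, (EuclideanSpace.proj (𝕜 := ℝ) i).integrable_comp hi⟩
    refine ae_eq_of_integral_contDiff_smul_eq (loc g h.locallyIntegrable_grad)
      (loc g' h'.locallyIntegrable_grad) ?_
    intro φ hφ hc
    have e := h.integral_eq φ hφ hc i
    rw [h'.integral_eq φ hφ hc i, neg_inj] at e
    simpa [smul_eq_mul, mul_comm] using e.symm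
  filter_upwards [ae_all_iff.2 key] with x hx
  ext i
  exact hx i

open Classical in
/-- The weak gradient `∇u` of `u` (and `0` if `u` has none). -/
def weakGradient {N : ℕ} (u : EuclideanSpace ℝ (Fin N) → ℝ) :
    EuclideanSpace ℝ (Fin N) → EuclideanSpace ℝ (Fin N) :=
  if h : ∃ g, HasWeakGradient u g then h.choose else 0

/-- The Sobolev space `W^{1,2}(ℝ^N)` of real functions: `u ∈ L²` with a weak gradient in `L²`. -/
def sobolevW12 (N : ℕ) : Set (EuclideanSpace ℝ (Fin N) → ℝ) :=
  {u | MemLp u 2 volume ∧ ∃ g, HasWeakGradient u g ∧ MemLp g 2 volume}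

/-- `{u ∈ W^{1,2}(ℝ^N) : ‖x u‖₂ < ∞}`. -/
def heisenbergSpace (N : ℕ) : Set (EuclideanSpace ℝ (Fin N) → ℝ) :=
  {u | u ∈ sobolevW12 N ∧ MemLp (fun x => u x • x) 2 volume}

/-- The Heisenberg deficit `δ₁(u) = ‖∇u‖₂ ‖x u‖₂ - (N/2) ‖u‖₂²`. -/
def heisenbergDeficit {N : ℕ} (u : EuclideanSpace ℝ (Fin N) → ℝ) : ℝ :=
  √(∫ x, ‖weakGradient u x‖ ^ 2) * √(∫ x, ‖x‖ ^ 2 * u x ^ 2) - (N : ℝ) / 2 * ∫ x, u x ^ 2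

/-- The Gaussian function `x ↦ c e^{-α|x|²}`. -/
def gaussianFn {N : ℕ} (c α : ℝ) (x : EuclideanSpace ℝ (Fin N)) : ℝ :=
  c * Real.exp (-α * ‖x‖ ^ 2)

/-- The squared `L²` distance from `u` to the Gaussians,
`inf {‖u - c e^{-α|x|²}‖₂² : c ∈ ℝ, α > 0}`. -/
def gaussianDistSq {N : ℕ} (u : EuclideanSpace ℝ (Fin N) → ℝ) : ℝ :=
  sInf {d | ∃ c α : ℝ, 0 < α ∧ d = ∫ x, (u x - gaussianFn c α x) ^ 2}

/-- The squared `L²` distance from `u` to the Gaussians of the same `L²` norm,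
`inf {‖u - c e^{-α|x|²}‖₂² : c ∈ ℝ, α > 0, ‖u‖₂ = ‖c e^{-α|x|²}‖₂}`. -/
def gaussianDistSqSameNorm {N : ℕ} (u : EuclideanSpace ℝ (Fin N) → ℝ) : ℝ :=
  sInf {d | ∃ c α : ℝ, 0 < α ∧
    (∫ x, u x ^ 2 = ∫ x : EuclideanSpace ℝ (Fin N), gaussianFn c α x ^ 2) ∧
    d = ∫ x, (u x - gaussianFn c α x) ^ 2}

/-- The function `x ↦ xᵢ e^{-|x|²/2}`. -/
def hermiteGaussian {N : ℕ} (i : Fin N) (x : EuclideanSpace ℝ (Fin N)) : ℝ :=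
  x i * Real.exp (-‖x‖ ^ 2 / 2)

end

/-! The harmonic oscillator `-Δ + |x|²` has the Hermite functions as eigenfunctions, with
eigenvalues `N + 2|k|`. Only the ground state, the Gaussian, has eigenvalue `N`; everything
orthogonal to it pays at least `2` more. Hence `‖∇u‖² + ‖xu‖² ≥ N‖u‖² + 2 dist²`, where `dist` is
the distance from `u` to the line of `e^{-|x|²/2}` (`energy_ge_projection`). Applied to the dilate
`u(r·)`, this bounds `r²‖∇u‖² + r⁻²‖xu‖²` by the distance to another Gaussian line; the `r` that
balances the two terms turns the left side into `2‖∇u‖‖xu‖`, and halving gives the first estimate.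

For the second, the projection is stretched to the norm of `u`, which at most doubles the squared
distance.

For sharpness, `x₁e^{-|x|²/2}` lies in the first excited level, so its deficit is exactly `‖u‖²`; it
is odd, hence orthogonal to every Gaussian, and its two squared distances are `‖u‖²` and `2‖u‖²`.

The spectral expansion of the energy (`hasSum_energy`) is obtained by Parseval from the Hermite
coefficients of `∂ᵢu` and `xᵢu`, which the ladder relations express through those of `u`. -/

/-! ### Hermite functions in one variable -/

/-- The physicists' Hermite polynomials, with real coefficients. -/
noncomputable def hermitePoly : ℕ → Polynomial ℝ
  | 0 => 1
  | n + 1 => 2 * Polynomial.X * hermitePoly n - Polynomial.derivative (hermitePoly n)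

theorem derivative_hermitePoly_succ (n : ℕ) :
    Polynomial.derivative (hermitePoly (n + 1)) = (2 * (n + 1 : ℝ)) • hermitePoly n := by
  induction n with
  | zero =>
    have : (Polynomial.C (2 : ℝ)) = 2 := rfl
    simp [hermitePoly, Polynomial.smul_eq_C_mul, this]
  | succ n ih =>
    have h : hermitePoly (n + 2) =
      2 * Polynomial.X * hermitePoly (n + 1) - Polynomial.derivative (hermitePoly (n + 1)) := rfl
    have h' : hermitePoly (n + 1) =
      2 * Polynomial.X * hermitePoly n - Polynomial.derivative (hermitePoly n) := rfl
    rw [h, Polynomial.derivative_sub, ih, Polynomial.derivative_mul, ih, Polynomial.derivative_smul]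
    have e : Polynomial.derivative (hermitePoly n) =
      2 * Polynomial.X * hermitePoly n - hermitePoly (n + 1) := by rw [h']; ring
    rw [e]
    simp only [Polynomial.smul_eq_C_mul, Polynomial.derivative_mul, Polynomial.derivative_ofNat,
      Polynomial.derivative_X, Nat.cast_add, Nat.cast_one, Polynomial.C_mul, Polynomial.C_add,
      Polynomial.C_1]
    have : (Polynomial.C (2 : ℝ)) = 2 := rfl
    rw [this]
    ring

/-- The one-dimensional Hermite function `H_n(t) e^{-t²/2}`, not normalised. -/
noncomputable def hermiteFun (n : ℕ) (t : ℝ) : ℝ :=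
  (hermitePoly n).eval t * Real.exp (-t ^ 2 / 2)

theorem contDiff_hermiteFun (n : ℕ) : ContDiff ℝ ∞ (hermiteFun n) := by
  unfold hermiteFun
  have := (hermitePoly n).contDiff_aeval (R := ℝ) (𝕜 := ℝ) ∞
  simp only [Polynomial.coe_aeval_eq_eval] at this
  exact this.mul (by fun_prop)

theorem hasDerivAt_hermiteFun_aux (n : ℕ) (t : ℝ) :
    HasDerivAt (hermiteFun n) (((Polynomial.derivative (hermitePoly n)).eval t
      - t * (hermitePoly n).eval t) * Real.exp (-t ^ 2 / 2)) t := by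
  unfold hermiteFun
  have h1 := (hermitePoly n).hasDerivAt t
  have h2 : HasDerivAt (fun t : ℝ => Real.exp (-t ^ 2 / 2)) (Real.exp (-t ^ 2 / 2) * (-t)) t := by
    have : HasDerivAt (fun t : ℝ => -t ^ 2 / 2) (-t) t := by
      have h : HasDerivAt (fun t : ℝ => t ^ 2) (2 * t) t := by simpa using hasDerivAt_pow 2 t
      refine (h.fun_neg.div_const 2).congr_deriv ?_
      ring
    exact this.exp
  refine (h1.fun_mul h2).congr_deriv ?_
  ring

/-- The truncated index `n - 1` is harmless at `n = 0`, where the factor `n` vanishes; the same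
convention runs through all ladder relations below. -/
theorem eval_derivative_hermitePoly (n : ℕ) (t : ℝ) :
    (Polynomial.derivative (hermitePoly n)).eval t = 2 * n * (hermitePoly (n - 1)).eval t := by
  cases n with
  | zero => simp [hermitePoly]
  | succ n => simp [derivative_hermitePoly_succ]

theorem hermiteFun_succ (n : ℕ) (t : ℝ) : hermiteFun (n + 1) t =
    2 * t * hermiteFun n t - 2 * n * hermiteFun (n - 1) t := by
  simp only [hermiteFun, hermitePoly, Polynomial.eval_sub, Polynomial.eval_mul,
    eval_derivative_hermitePoly, Polynomial.eval_X, Polynomial.eval_ofNat]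
  ring

theorem mul_hermiteFun (n : ℕ) (t : ℝ) :
    t * hermiteFun n t = hermiteFun (n + 1) t / 2 + n * hermiteFun (n - 1) t := by
  rw [hermiteFun_succ]; ring

theorem hasDerivAt_hermiteFun (n : ℕ) (t : ℝ) :
    HasDerivAt (hermiteFun n) (n * hermiteFun (n - 1) t - hermiteFun (n + 1) t / 2) t := by
  convert hasDerivAt_hermiteFun_aux n t using 1
  rw [hermiteFun_succ, eval_derivative_hermitePoly]
  simp only [hermiteFun]
  ring

theorem integrable_polynomial_mul_exp_neg_sq (p : Polynomial ℝ) :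
    Integrable (fun t : ℝ => p.eval t * Real.exp (-t ^ 2)) := by
  induction p using Polynomial.induction_on' with
  | add p q hp hq =>
    simp only [Polynomial.eval_add, add_mul]
    exact hp.add hq
  | monomial n a =>
    have h := (integrable_rpow_mul_exp_neg_mul_sq (b := 1) one_pos (s := n)
      (by linarith [Nat.cast_nonneg (α := ℝ) n])).const_mul a
    refine h.congr (Filter.Eventually.of_forall fun t => ?_)
    simp [mul_assoc]

theorem integrable_hermiteFun_mul (m n : ℕ) :
    Integrable (fun t => hermiteFun m t * hermiteFun n t) := by
  refine (integrable_polynomial_mul_exp_neg_sq (hermitePoly m * hermitePoly n)).congr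
    (Filter.Eventually.of_forall fun t => ?_)
  simp only [hermiteFun, Polynomial.eval_mul]
  have : Real.exp (-t ^ 2) = Real.exp (-t ^ 2 / 2) * Real.exp (-t ^ 2 / 2) := by
    rw [← Real.exp_add]; ring_nf
  rw [this]; ring

/-- `∫ H_n² e^{-t²}`. -/
noncomputable def hermiteNorm (n : ℕ) : ℝ := 2 ^ n * n.factorial * √Real.pi

theorem hermiteNorm_pos (n : ℕ) : 0 < hermiteNorm n := by
  unfold hermiteNorm; positivity

theorem hermiteNorm_succ (n : ℕ) : hermiteNorm (n + 1) = 2 * (n + 1) * hermiteNorm n := by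
  simp only [hermiteNorm, Nat.factorial_succ]; push_cast; ring

/-- Raising is `t - d/dt` and lowering is `t + d/dt`; integration by parts makes them adjoint.
Iterating lowers both indices together, which yields orthogonality and the norms. -/
theorem integral_hermiteFun_succ_mul (m n : ℕ) :
    ∫ t, hermiteFun (m + 1) t * hermiteFun n t =
      2 * n * ∫ t, hermiteFun m t * hermiteFun (n - 1) t := by
  have ibp := integral_mul_deriv_eq_deriv_mul_of_integrable (u := hermiteFun m)
    (v := hermiteFun n) (u' := fun t => m * hermiteFun (m - 1) t - hermiteFun (m + 1) t / 2)
    (v' := fun t => n * hermiteFun (n - 1) t - hermiteFun (n + 1) t / 2) (fun t _ => hasDerivAt_hermiteFun m t) (fun t _ => hasDerivAt_hermiteFun n t)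
    (by
      refine (((integrable_hermiteFun_mul m (n - 1)).const_mul n).sub
        ((integrable_hermiteFun_mul m (n + 1)).const_mul (1 / 2))).congr
        (Filter.Eventually.of_forall fun t => ?_)
      simp only [Pi.sub_apply, Pi.mul_apply]; ring)
    (by
      refine (((integrable_hermiteFun_mul (m - 1) n).const_mul m).sub
        ((integrable_hermiteFun_mul (m + 1) n).const_mul (1 / 2))).congr
        (Filter.Eventually.of_forall fun t => ?_)
      simp only [Pi.sub_apply, Pi.mul_apply]; ring)
    (integrable_hermiteFun_mul m n)
  have e1 : (∫ t, hermiteFun m t * (n * hermiteFun (n - 1) t - hermiteFun (n + 1) t / 2)) =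
      2 * n * (∫ t, hermiteFun m t * hermiteFun (n - 1) t)
        - ∫ t, t * (hermiteFun m t * hermiteFun n t) := by
    rw [← integral_const_mul, ← integral_sub ((integrable_hermiteFun_mul _ _).const_mul _)]
    · congr 1; ext t; rw [hermiteFun_succ]; ring
    · refine (((integrable_hermiteFun_mul m (n + 1)).const_mul (1 / 2)).add
        ((integrable_hermiteFun_mul m (n - 1)).const_mul n)).congr
        (Filter.Eventually.of_forall fun t => ?_)
      have := mul_hermiteFun n t
      simp only [Pi.add_apply]
      linear_combination - hermiteFun m t * this
  have e2 : (∫ t, (m * hermiteFun (m - 1) t - hermiteFun (m + 1) t / 2) * hermiteFun n t) =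
      (∫ t, t * (hermiteFun m t * hermiteFun n t)) -
        ∫ t, hermiteFun (m + 1) t * hermiteFun n t := by
    rw [← integral_sub _ (integrable_hermiteFun_mul _ _)]
    · congr 1; ext t; linear_combination - hermiteFun n t * (mul_hermiteFun m t)
    · refine (((integrable_hermiteFun_mul (m + 1) n).const_mul (1 / 2)).add
        ((integrable_hermiteFun_mul (m - 1) n).const_mul m)).congr
        (Filter.Eventually.of_forall fun t => ?_)
      simp only [Pi.add_apply]
      linear_combination - hermiteFun n t * (mul_hermiteFun m t)
  rw [e1, e2] at ibp
  linarith

theorem integral_hermiteFun_mul (m n : ℕ) :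
    ∫ t, hermiteFun m t * hermiteFun n t = if m = n then hermiteNorm n else 0 := by
  induction m generalizing n with
  | zero =>
    cases n with
    | zero =>
      have : ∀ t, hermiteFun 0 t * hermiteFun 0 t = Real.exp (-1 * t ^ 2) := by
        intro t; simp only [hermiteFun, hermitePoly, Polynomial.eval_one, one_mul]
        rw [← Real.exp_add]; ring_nf
      simp only [this, integral_gaussian]
      simp [hermiteNorm]
    | succ n =>
      have := integral_hermiteFun_succ_mul n 0
      simp only [mul_comm (hermiteFun 0 _)]
      rw [this]; simp
  | succ m ih =>
    rw [integral_hermiteFun_succ_mul, ih]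
    cases n with
    | zero => simp
    | succ n => simp [hermiteNorm_succ]

/-! ### Hermite functions on `ℝ^N` and their ladder relations -/

section MultiDimensional

variable {N : ℕ}

/-- The Hermite function `∏ⱼ H_{kⱼ}(xⱼ) e^{-|x|²/2}` on `ℝ^N`, not normalised. -/
noncomputable def multiHermite (k : Fin N → ℕ) (x : EuclideanSpace ℝ (Fin N)) : ℝ :=
  ∏ j, hermiteFun (k j) (x j)

/-- `‖multiHermite k‖₂²`. -/
noncomputable def multiHermiteNorm (k : Fin N → ℕ) : ℝ := ∏ j, hermiteNorm (k j)

theorem multiHermiteNorm_pos (k : Fin N → ℕ) : 0 < multiHermiteNorm k :=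
  Finset.prod_pos fun _ _ => hermiteNorm_pos _

theorem contDiff_multiHermite (k : Fin N → ℕ) : ContDiff ℝ ∞ (multiHermite k) := by
  unfold multiHermite
  refine contDiff_prod fun j _ => (contDiff_hermiteFun (k j)).comp ?_
  exact (EuclideanSpace.proj (𝕜 := ℝ) j).contDiff

theorem multiHermite_zero (x : EuclideanSpace ℝ (Fin N)) :
    multiHermite 0 x = Real.exp (-‖x‖ ^ 2 / 2) := by
  simp only [multiHermite, hermiteFun, hermitePoly, Polynomial.eval_one, one_mul]
  rw [← Real.exp_sum, EuclideanSpace.real_norm_sq_eq, ← Finset.sum_div, Finset.sum_neg_distrib]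

theorem integrable_prod_coord (f : Fin N → ℝ → ℝ) (hf : ∀ j, Integrable (f j)) :
    Integrable (fun x : EuclideanSpace ℝ (Fin N) => ∏ j, f j (x j)) := by
  have h : Integrable (fun x : Fin N → ℝ => ∏ j, f j (x j)) := Integrable.fintype_prod hf
  exact ((EuclideanSpace.volume_preserving_symm_measurableEquiv_toLp (Fin N)).integrable_comp_emb
    (MeasurableEquiv.measurableEmbedding _)).2 h

theorem integral_prod_coord (f : Fin N → ℝ → ℝ) :
    ∫ x : EuclideanSpace ℝ (Fin N), ∏ j, f j (x j) = ∏ j, ∫ t, f j t := by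
  rw [← integral_fintype_prod_volume_eq_prod]
  exact (EuclideanSpace.volume_preserving_symm_measurableEquiv_toLp (Fin N)).integral_comp
    (MeasurableEquiv.measurableEmbedding _) (fun x : Fin N → ℝ => ∏ j, f j (x j))

theorem integral_multiHermite_mul (k l : Fin N → ℕ) :
    ∫ x, multiHermite k x * multiHermite l x = if k = l then multiHermiteNorm l else 0 := by
  simp only [multiHermite, ← Finset.prod_mul_distrib]
  rw [integral_prod_coord fun j t => hermiteFun (k j) t * hermiteFun (l j) t]
  simp only [integral_hermiteFun_mul]
  split_ifs with h
  · subst h; simp [multiHermiteNorm]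
  · obtain ⟨j, hj⟩ := Function.ne_iff.1 h
    exact Finset.prod_eq_zero (Finset.mem_univ j) (by simp [hj])

theorem integral_multiHermite_sq (k : Fin N → ℕ) :
    ∫ x, multiHermite k x ^ 2 = multiHermiteNorm k := by
  simpa [pow_two] using integral_multiHermite_mul k k

theorem memLp_multiHermite (k : Fin N → ℕ) : MemLp (multiHermite k) 2 volume := by
  rw [memLp_two_iff_integrable_sq (contDiff_multiHermite k).continuous.aestronglyMeasurable]
  simp only [multiHermite, pow_two, ← Finset.prod_mul_distrib]
  exact integrable_prod_coord (fun j t => hermiteFun (k j) t * hermiteFun (k j) t)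
    fun j => integrable_hermiteFun_mul _ _

/-- Splits off the only factor affected by a shift of `k` in direction `i`, so that one-variable
identities carry over to products. -/
theorem prod_single_ladder {M : Type*} [CommMonoid M] (f : Fin N → ℕ → M) (k l : Fin N → ℕ)
    (i : Fin N) (h : ∀ j, j ≠ i → l j = k j) :
    ∏ j, f j (l j) = f i (l i) * ∏ j ∈ Finset.univ.erase i, f j (k j) := by
  rw [← Finset.mul_prod_erase _ _ (Finset.mem_univ i)]
  congr 1
  exact Finset.prod_congr rfl fun j hj => by rw [h j (Finset.ne_of_mem_erase hj)]

theorem mul_multiHermite (k : Fin N → ℕ) (i : Fin N) (x : EuclideanSpace ℝ (Fin N)) :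
    x i * multiHermite k x = multiHermite (k + Pi.single i 1) x / 2
      + k i * multiHermite (k - Pi.single i 1) x := by
  have hf := prod_single_ladder (fun j n => hermiteFun n (x j)) k
  simp only [multiHermite]
  rw [hf k i (fun _ _ => rfl), hf (k + Pi.single i 1) i (fun j hj => by simp [hj]),
    hf (k - Pi.single i 1) i (fun j hj => by simp [hj])]
  simp only [Pi.add_apply, Pi.sub_apply, Pi.single_eq_same]
  rw [← mul_assoc, mul_hermiteFun]; ring

theorem fderiv_multiHermite (k : Fin N → ℕ) (i : Fin N) (x : EuclideanSpace ℝ (Fin N)) :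
    fderiv ℝ (multiHermite k) x (EuclideanSpace.single i 1) =
      k i * multiHermite (k - Pi.single i 1) x - multiHermite (k + Pi.single i 1) x / 2 := by
  have hd := (((contDiff_multiHermite k).differentiable (by simp)) x).hasFDerivAt.hasLineDerivAt
    (EuclideanSpace.single i 1)
  refine hd.unique ?_
  have hf := fun x : EuclideanSpace ℝ (Fin N) =>
    prod_single_ladder (fun j n => hermiteFun n (x j)) k
  -- Along a line in direction `i` only the `i`-th factor varies.
  have e : (fun t : ℝ => multiHermite k (x + t • EuclideanSpace.single i 1)) =
      fun t => hermiteFun (k i) (x i + t) *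
        ∏ j ∈ Finset.univ.erase i, hermiteFun (k j) (x j) := by
    ext t
    simp only [multiHermite]
    rw [hf _ k i (fun _ _ => rfl)]
    congr 1
    · simp
    · exact Finset.prod_congr rfl fun j hj => by simp [Finset.ne_of_mem_erase hj]
  rw [HasLineDerivAt, e]
  have h1 : HasDerivAt (fun t => hermiteFun (k i) (x i + t))
      (k i * hermiteFun (k i - 1) (x i) - hermiteFun (k i + 1) (x i) / 2) 0 := by
    have := hasDerivAt_hermiteFun (k i) (x i + 0)
    have := this.comp_const_add (x i) 0
    simpa using this
  refine (h1.mul_const (∏ j ∈ Finset.univ.erase i, hermiteFun (k j) (x j))).congr_deriv ?_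
  simp only [multiHermite]
  rw [hf x (k + Pi.single i 1) i (fun j hj => by simp [hj]),
    hf x (k - Pi.single i 1) i (fun j hj => by simp [hj])]
  simp only [Pi.add_apply, Pi.sub_apply, Pi.single_eq_same]
  ring

theorem multiHermiteNorm_add_single (k : Fin N → ℕ) (i : Fin N) :
    multiHermiteNorm (k + Pi.single i 1) = 2 * (k i + 1) * multiHermiteNorm k := by
  have hf := prod_single_ladder (fun (_ : Fin N) n => hermiteNorm n) k
  simp only [multiHermiteNorm]
  rw [hf k i (fun _ _ => rfl), hf (k + Pi.single i 1) i (fun j hj => by simp [hj])]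
  simp [hermiteNorm_succ]
  ring

end MultiDimensional

/-! ### Completeness of the Hermite functions and Parseval's identity -/

open scoped FourierTransform RealInnerProductSpace in
-- By duality: every test function is `𝓕 T` with `T` Schwartz, and `∫ f 𝓕T = ∫ 𝓕f T = 0`.
theorem ae_eq_zero_of_fourier_eq_zero {V : Type*} [NormedAddCommGroup V] [InnerProductSpace ℝ V]
    [FiniteDimensional ℝ V] [MeasurableSpace V] [BorelSpace V] {f : V → ℂ} (hf : Integrable f)
    (h : 𝓕 f = 0) : f =ᵐ[volume] 0 := by
  refine ae_eq_zero_of_integral_contDiff_smul_eq_zero hf.locallyIntegrable fun φ hφ hc => ?_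
  have hc' : HasCompactSupport (fun x => (φ x : ℂ)) := hc.comp_left (g := fun r : ℝ => (r : ℂ)) rfl
  have hφ' : ContDiff ℝ ∞ (fun x => (φ x : ℂ)) := Complex.ofRealCLM.contDiff.comp hφ
  let S := hc'.toSchwartzMap hφ'
  let T : SchwartzMap V ℂ := 𝓕⁻ S
  have hS : 𝓕 T = S := FourierTransform.fourier_fourierInv_eq S
  have hS' : ∀ x, 𝓕 (T : V → ℂ) x = φ x := fun x => congrArg (fun R : SchwartzMap V ℂ => R x) hS
  have key : ∫ ξ, 𝓕 f ξ • T ξ = ∫ x, f x • 𝓕 (T : V → ℂ) x := by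
    simpa using! VectorFourier.integral_fourierIntegral_smul_eq_flip (L := innerₗ V)
      Real.continuous_fourierChar continuous_inner hf T.integrable
  rw [h] at key
  simp only [Pi.zero_apply, zero_smul, integral_zero] at key
  rw [key]
  congr 1; ext x
  rw [hS', Complex.real_smul, smul_eq_mul, mul_comm]

section

variable {N : ℕ}

/-- The real span of the Hermite functions: polynomials times the Gaussian. -/
noncomputable def hermiteSpan (N : ℕ) : Submodule ℝ (EuclideanSpace ℝ (Fin N) → ℝ) :=
  Submodule.span ℝ (Set.range multiHermite)

theorem coord_mul_mem_hermiteSpan {q : EuclideanSpace ℝ (Fin N) → ℝ} (hq : q ∈ hermiteSpan N)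
    (i : Fin N) : (fun x => x i * q x) ∈ hermiteSpan N := by
  induction hq using Submodule.span_induction with
  | mem q hq =>
    obtain ⟨k, rfl⟩ := hq
    have e : (fun x : EuclideanSpace ℝ (Fin N) => x i * multiHermite k x) =
        (1 / 2 : ℝ) • multiHermite (k + Pi.single i 1) +
          (k i : ℝ) • multiHermite (k - Pi.single i 1) := by
      ext x
      rw [mul_multiHermite]
      simp only [Pi.add_apply, Pi.smul_apply, smul_eq_mul]; ring
    rw [e]
    exact Submodule.add_mem _ (Submodule.smul_mem _ _ (Submodule.subset_span ⟨_, rfl⟩))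
      (Submodule.smul_mem _ _ (Submodule.subset_span ⟨_, rfl⟩))
  | zero =>
    simp only [Pi.zero_apply, mul_zero]
    exact (hermiteSpan N).zero_mem
  | add p q _ _ hp hq => simpa [mul_add] using! (hermiteSpan N).add_mem hp hq
  | smul a q _ hq =>
    convert (hermiteSpan N).smul_mem a hq using 1
    ext x; simp only [Pi.smul_apply, smul_eq_mul]; ring

theorem inner_mul_mem_hermiteSpan {q : EuclideanSpace ℝ (Fin N) → ℝ} (hq : q ∈ hermiteSpan N)
    (t : EuclideanSpace ℝ (Fin N)) : (fun x => inner ℝ x t * q x) ∈ hermiteSpan N := by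
  have e : (fun x : EuclideanSpace ℝ (Fin N) => inner ℝ x t * q x) =
      ∑ i, t i • fun x : EuclideanSpace ℝ (Fin N) => x i * q x := by
    ext x
    simp only [PiLp.inner_apply, Finset.sum_apply, Pi.smul_apply, smul_eq_mul, Finset.sum_mul]
    refine Finset.sum_congr rfl fun i _ => ?_
    simp
    ring
  rw [e]
  exact Submodule.sum_mem _ fun i _ => Submodule.smul_mem _ _ (coord_mul_mem_hermiteSpan hq i)

theorem inner_pow_mul_mem_hermiteSpan (t : EuclideanSpace ℝ (Fin N)) (n : ℕ) :
    (fun x => inner ℝ x t ^ n * multiHermite 0 x) ∈ hermiteSpan N := by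
  induction n with
  | zero => simpa using! Submodule.subset_span (R := ℝ) (Set.mem_range_self (f := multiHermite (N := N)) 0)
  | succ n ih =>
    have := inner_mul_mem_hermiteSpan ih t
    simpa only [pow_succ', mul_assoc] using this

theorem memLp_of_mem_hermiteSpan {q : EuclideanSpace ℝ (Fin N) → ℝ} (hq : q ∈ hermiteSpan N) :
    MemLp q 2 volume := by
  induction hq using Submodule.span_induction with
  | mem q hq => obtain ⟨k, rfl⟩ := hq; exact memLp_multiHermite k
  | zero => exact MemLp.zero
  | add p q _ _ hp hq => exact hp.add hq
  | smul a q _ hq => exact hq.const_smul a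

theorem integral_mul_eq_zero_of_mem_hermiteSpan {f : EuclideanSpace ℝ (Fin N) → ℝ}
    (hf : MemLp f 2 volume) (h : ∀ k, ∫ x, f x * multiHermite k x = 0)
    {q : EuclideanSpace ℝ (Fin N) → ℝ} (hq : q ∈ hermiteSpan N) : ∫ x, f x * q x = 0 := by
  induction hq using Submodule.span_induction with
  | mem q hq => obtain ⟨k, rfl⟩ := hq; exact h k
  | zero => simp
  | add p q hp hq ihp ihq =>
    simp only [Pi.add_apply, mul_add]
    refine (integral_add (hf.integrable_mul (memLp_of_mem_hermiteSpan hp))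
      (hf.integrable_mul (memLp_of_mem_hermiteSpan hq))).trans ?_
    exact (congrArg₂ (· + ·) ihp ihq).trans (add_zero 0)
  | smul a q _ ih =>
    simp only [Pi.smul_apply, smul_eq_mul, mul_left_comm _ a]
    rw [integral_const_mul, ih, mul_zero]

theorem memLp_exp_inner_mul_multiHermite_zero (t : EuclideanSpace ℝ (Fin N)) :
    MemLp (fun x => Real.exp (inner ℝ x t) * multiHermite 0 x) 2 volume := by
  have hc : Continuous (fun x => Real.exp (inner ℝ x t) * multiHermite (N := N) 0 x) :=
    (by fun_prop : Continuous fun x : EuclideanSpace ℝ (Fin N) => Real.exp (inner ℝ x t)).mul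
      (contDiff_multiHermite 0).continuous
  rw [memLp_two_iff_integrable_sq hc.aestronglyMeasurable]
  have h := (GaussianFourier.integrable_cexp_neg_mul_sq_norm_add (b := 1) (by simp) 2 t).re
  refine h.congr (Filter.Eventually.of_forall fun x => ?_)
  simp only [multiHermite_zero]
  rw [← Real.exp_add, ← Real.exp_nat_mul]
  have : (-1 * (‖x‖ : ℂ) ^ 2 + 2 * (inner ℝ t x : ℝ)) =
      ((-‖x‖ ^ 2 + 2 * inner ℝ t x : ℝ) : ℂ) := by push_cast; ring
  rw [this, ← Complex.ofReal_exp]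
  simp only [RCLike.re_to_complex, Complex.ofReal_re, real_inner_comm x t]
  congr 1; push_cast; ring

/-- Since `e^{|s|} ≤ e^s + e^{-s}`. Multiplied by `f ∈ L²`, this function provides the integrable
bound for the exponential series in the completeness proof. -/
theorem memLp_exp_abs_inner_mul_multiHermite_zero (t : EuclideanSpace ℝ (Fin N)) :
    MemLp (fun x => Real.exp |inner ℝ x t| * multiHermite 0 x) 2 volume := by
  have hc : Continuous (fun x => Real.exp |inner ℝ x t| * multiHermite (N := N) 0 x) :=
    (by fun_prop : Continuous fun x : EuclideanSpace ℝ (Fin N) => Real.exp |inner ℝ x t|).mul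
      (contDiff_multiHermite 0).continuous
  refine ((memLp_exp_inner_mul_multiHermite_zero t).add
    (memLp_exp_inner_mul_multiHermite_zero (-t))).mono hc.aestronglyMeasurable
    (Filter.Eventually.of_forall fun x => ?_)
  have hp : 0 < multiHermite 0 x := by rw [multiHermite_zero]; positivity
  simp only [Pi.add_apply, inner_neg_right]
  rw [Real.norm_of_nonneg (by positivity), Real.norm_of_nonneg (by positivity), ← add_mul]
  gcongr
  rcases abs_cases (inner ℝ x t : ℝ) with h | h <;> rw [h.1] <;>
    linarith [Real.exp_pos (inner ℝ x t : ℝ), Real.exp_pos (-inner ℝ x t : ℝ)]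

open scoped FourierTransform RealInnerProductSpace in
/-- Completeness of the Hermite functions in `L²`. -/
theorem ae_eq_zero_of_forall_integral_multiHermite {f : EuclideanSpace ℝ (Fin N) → ℝ}
    (hf : MemLp f 2 volume) (h : ∀ k, ∫ x, f x * multiHermite k x = 0) : f =ᵐ[volume] 0 := by
  have hF : Integrable (fun x => ((f x * multiHermite 0 x : ℝ) : ℂ)) :=
    (hf.integrable_mul (memLp_multiHermite 0)).ofReal
  -- It suffices that `f` times the Gaussian has zero Fourier transform, as the Gaussian never
  -- vanishes.
  have hz := ae_eq_zero_of_fourier_eq_zero hF ?_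
  · filter_upwards [hz] with x hx
    have hp : 0 < multiHermite 0 x := by rw [multiHermite_zero]; positivity
    have : f x * multiHermite 0 x = 0 := Complex.ofReal_eq_zero.1 hx
    simpa [hp.ne'] using this
  ext ξ
  rw [Real.fourier_eq']
  -- The character is expanded in its power series; each term is a polynomial times the Gaussian,
  -- hence in the Hermite span and orthogonal to `f`.
  have hpow : ∀ n : ℕ, ∫ x, ((inner ℝ x (-(2 * Real.pi) • ξ) : ℝ) * Complex.I) ^ n / n.factorial *
      ((f x * multiHermite 0 x : ℝ) : ℂ) = 0 := by
    intro n
    have := integral_mul_eq_zero_of_mem_hermiteSpan hf h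
      (inner_pow_mul_mem_hermiteSpan (-(2 * Real.pi) • ξ) n)
    have e : ∀ x, ((inner ℝ x (-(2 * Real.pi) • ξ) : ℝ) * Complex.I) ^ n / n.factorial *
      ((f x * multiHermite 0 x : ℝ) : ℂ) = (Complex.I ^ n / n.factorial) *
        ((f x * (inner ℝ x (-(2 * Real.pi) • ξ) ^ n * multiHermite 0 x) : ℝ) : ℂ) := by
      intro x; push_cast; ring
    simp only [e]
    rw [integral_const_mul, integral_complex_ofReal, this]
    simp
  have hsum := hasSum_integral_of_dominated_convergence (μ := volume)
    (F := fun (n : ℕ) x => ((inner ℝ x (-(2 * Real.pi) • ξ) : ℝ) * Complex.I) ^ n / n.factorial *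
      ((f x * multiHermite 0 x : ℝ) : ℂ))
    (f := fun x => Complex.exp ((inner ℝ x (-(2 * Real.pi) • ξ) : ℝ) * Complex.I) *
      ((f x * multiHermite 0 x : ℝ) : ℂ))
    (fun n x => |inner ℝ x (-(2 * Real.pi) • ξ)| ^ n / n.factorial * |f x * multiHermite 0 x|)
    (fun n => (Continuous.aestronglyMeasurable (by fun_prop)).mul hF.aestronglyMeasurable)
    (fun n => Filter.Eventually.of_forall fun x => by
      simp)
    (Filter.Eventually.of_forall fun x => (Real.summable_pow_div_factorial _).mul_right _)
    ?_
    (Filter.Eventually.of_forall fun x => by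
      have := NormedSpace.expSeries_div_hasSum_exp
        ((inner ℝ x (-(2 * Real.pi) • ξ) : ℝ) * Complex.I)
      rw [← Complex.exp_eq_exp_ℂ] at this
      exact this.mul_right _)
  · simp only [hpow] at hsum
    have := hsum.unique hasSum_zero
    rw [Pi.zero_apply, ← this]
    congr 1; ext x
    rw [inner_smul_right, smul_eq_mul]
    push_cast
    ring_nf
  · have e : ∀ x : EuclideanSpace ℝ (Fin N), ∑' n : ℕ, |inner ℝ x (-(2 * Real.pi) • ξ)| ^ n /
        n.factorial * |f x * multiHermite 0 x| =
        ‖f x * (Real.exp |inner ℝ x (-(2 * Real.pi) • ξ)| * multiHermite 0 x)‖ := by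
      intro x
      have he : ∀ s : ℝ, ∑' n : ℕ, s ^ n / n.factorial = Real.exp s := fun s => by
        rw [Real.exp_eq_exp_ℝ, NormedSpace.exp_eq_tsum_div]
      rw [tsum_mul_right, he, norm_mul, norm_mul, Real.norm_of_nonneg (Real.exp_nonneg _), abs_mul]
      simp only [Real.norm_eq_abs]
      ring
    simp only [e]
    exact (hf.integrable_mul (memLp_exp_abs_inner_mul_multiHermite_zero _)).norm

/-- The normalised Hermite functions as elements of `L²`. -/
noncomputable def hermiteLp (k : Fin N → ℕ) : Lp ℝ 2 (volume : Measure (EuclideanSpace ℝ (Fin N))) :=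
  ((memLp_multiHermite k).const_mul (√(multiHermiteNorm k))⁻¹).toLp

theorem inner_hermiteLp (k : Fin N → ℕ) {f : EuclideanSpace ℝ (Fin N) → ℝ}
    (hf : MemLp f 2 volume) :
    inner ℝ (hermiteLp k) hf.toLp = (√(multiHermiteNorm k))⁻¹ * ∫ x, f x * multiHermite k x := by
  rw [L2.inner_def, ← integral_const_mul]
  refine integral_congr_ae ?_
  filter_upwards [hf.coeFn_toLp,
    ((memLp_multiHermite k).const_mul (√(multiHermiteNorm k))⁻¹).coeFn_toLp] with x h1 h2
  rw [hermiteLp, h1, h2]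
  simp only [RCLike.inner_apply, conj_trivial]
  ring

theorem orthonormal_hermiteLp : Orthonormal ℝ (hermiteLp (N := N)) := by
  rw [orthonormal_iff_ite]
  intro k l
  rw [show hermiteLp l = ((memLp_multiHermite l).const_mul (√(multiHermiteNorm l))⁻¹).toLp from rfl,
    inner_hermiteLp]
  simp only [mul_assoc]
  rw [integral_const_mul, integral_multiHermite_mul]
  simp only [eq_comm (a := l)]
  split_ifs with h
  · subst h
    have hp := multiHermiteNorm_pos k
    have hs : √(multiHermiteNorm k) ≠ 0 := (Real.sqrt_pos.2 hp).ne'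
    field_simp
    rw [Real.sq_sqrt hp.le]
  · simp

/-- Parseval's identity for the Hermite functions. -/
theorem hasSum_integral_multiHermite_sq {f : EuclideanSpace ℝ (Fin N) → ℝ}
    (hf : MemLp f 2 volume) :
    HasSum (fun k => (∫ x, f x * multiHermite k x) ^ 2 / multiHermiteNorm k) (∫ x, f x ^ 2) := by
  -- Completeness in the form required for a Hilbert basis.
  have hbot : (Submodule.span ℝ (Set.range (hermiteLp (N := N))))ᗮ = ⊥ := by
    rw [Submodule.eq_bot_iff]
    intro g hg
    rw [Lp.eq_zero_iff_ae_eq_zero]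
    refine ae_eq_zero_of_forall_integral_multiHermite (Lp.memLp g) fun k => ?_
    have h := (Submodule.mem_orthogonal _ _).1 hg _ (Submodule.subset_span ⟨k, rfl⟩)
    rw [← Lp.toLp_coeFn g (Lp.memLp g), inner_hermiteLp] at h
    have hs : (√(multiHermiteNorm k))⁻¹ ≠ 0 :=
      inv_ne_zero (Real.sqrt_pos.2 (multiHermiteNorm_pos k)).ne'
    exact (mul_eq_zero.1 h).resolve_left hs
  have h := (HilbertBasis.mkOfOrthogonalEqBot orthonormal_hermiteLp hbot).hasSum_inner_mul_inner
    hf.toLp hf.toLp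
  rw [HilbertBasis.coe_mkOfOrthogonalEqBot] at h
  have e : inner ℝ hf.toLp hf.toLp = ∫ x, f x ^ 2 := by
    rw [L2.inner_def]
    refine integral_congr_ae ?_
    filter_upwards [hf.coeFn_toLp] with x h1
    rw [h1]
    simp [pow_two]
  rw [e] at h
  refine h.congr_fun fun k => ?_
  rw [real_inner_comm, inner_hermiteLp, mul_mul_mul_comm,
    ← mul_inv, Real.mul_self_sqrt (multiHermiteNorm_pos k).le]
  ring

end

/-! ### Spectral expansion of the energy and the spectral gap -/

section

variable {N : ℕ}

/-- The defining identity of the weak gradient extends from test functions to smooth `L²`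
functions with an `L²` derivative. -/
theorem HasWeakGradient.integral_eq_of_memLp {u : EuclideanSpace ℝ (Fin N) → ℝ}
    {g : EuclideanSpace ℝ (Fin N) → EuclideanSpace ℝ (Fin N)} (h : HasWeakGradient u g)
    (hu : MemLp u 2 volume) (hg : MemLp g 2 volume) {φ : EuclideanSpace ℝ (Fin N) → ℝ}
    (hφ : ContDiff ℝ ∞ φ) (hφ2 : MemLp φ 2 volume) (i : Fin N)
    (hφ' : MemLp (fun x => fderiv ℝ φ x (EuclideanSpace.single i 1)) 2 volume) :
    ∫ x, u x * fderiv ℝ φ x (EuclideanSpace.single i 1) = - ∫ x, g x i * φ x := by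
  let e : EuclideanSpace ℝ (Fin N) := EuclideanSpace.single i 1
  let b : ContDiffBump (0 : EuclideanSpace ℝ (Fin N)) := ⟨1, 2, one_pos, one_lt_two⟩
  let c : ℕ → ℝ := fun n => ((n : ℝ) + 1)⁻¹
  have hc0 : ∀ n, c n ≠ 0 := fun n => inv_ne_zero (by positivity)
  have hc : Filter.Tendsto c Filter.atTop (nhds 0) := by
    simpa [c] using tendsto_one_div_add_atTop_nhds_zero_nat (𝕜 := ℝ)
  have hc1 : ∀ n, |c n| ≤ 1 := fun n => by
    rw [abs_of_nonneg (by positivity)]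
    exact inv_le_one_of_one_le₀ (by linarith [Nat.cast_nonneg (α := ℝ) n])
  -- Cutoffs spreading over the whole space; their derivatives are at most `C · c n`, so the
  -- commutator term in the product rule tends to `0`.
  let χ : ℕ → EuclideanSpace ℝ (Fin N) → ℝ := fun n x => b (c n • x)
  have hbs : ContDiff ℝ ∞ (b : EuclideanSpace ℝ (Fin N) → ℝ) := b.contDiff
  have hχs : ∀ n, ContDiff ℝ ∞ (χ n) := fun n => hbs.comp (contDiff_const_smul (c n))
  have hχc : ∀ n, HasCompactSupport (χ n) := fun n => b.hasCompactSupport.comp_smul (hc0 n)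
  obtain ⟨C, hC⟩ : ∃ C, ∀ x, ‖fderiv ℝ b x e‖ ≤ C := by
    have h1 : HasCompactSupport (fun x => fderiv ℝ b x e) := b.hasCompactSupport.fderiv_apply ℝ e
    have h2 : Continuous (fun x => fderiv ℝ b x e) :=
      (hbs.continuous_fderiv (by simp)).clm_apply continuous_const
    exact h1.exists_bound_of_continuous h2
  have hC0 : 0 ≤ C := (norm_nonneg _).trans (hC 0)
  have hχ' : ∀ n x, fderiv ℝ (χ n) x e = c n * fderiv ℝ b (c n • x) e := by
    intro n x
    have := fderiv_comp_smul (𝕜 := ℝ) (f := (b : EuclideanSpace ℝ (Fin N) → ℝ)) (c n) (x := x)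
    simp only [χ]
    rw [this]; simp
  have hφd := hφ.differentiable (by simp)
  have hprod : ∀ n x, fderiv ℝ (fun x => φ x * χ n x) x e =
      fderiv ℝ φ x e * χ n x + c n * (fderiv ℝ b (c n • x) e * φ x) := by
    intro n x
    rw [fderiv_fun_mul (hφd x) ((hχs n).differentiable (by simp) x)]
    simp only [add_apply, smul_apply, hχ', smul_eq_mul]
    ring
  have hχlim : ∀ x, Filter.Tendsto (fun n => χ n x) Filter.atTop (nhds 1) := by
    intro x
    have h1 : Filter.Tendsto (fun n => c n • x) Filter.atTop (nhds 0) := by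
      simpa using hc.smul_const x
    have h2 : b 0 = 1 := b.one_of_mem_closedBall (by simp [b])
    have h3 := (b.continuous.tendsto 0).comp h1
    rwa [h2] at h3
  have hχ01 : ∀ n x, |χ n x| ≤ 1 := fun n x => by
    rw [abs_of_nonneg b.nonneg]; exact b.le_one
  have hgi : MemLp (fun x => g x i) 2 volume :=
    (EuclideanSpace.proj (𝕜 := ℝ) i).comp_memLp' hg
  have hL : Filter.Tendsto (fun n => ∫ x, u x * fderiv ℝ (fun x => φ x * χ n x) x e) Filter.atTop
      (nhds (∫ x, u x * fderiv ℝ φ x e)) := by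
    refine tendsto_integral_of_dominated_convergence
      (fun x => ‖u x * fderiv ℝ φ x e‖ + C * ‖u x * φ x‖) (fun n => ?_)
      ((hu.integrable_mul hφ').norm.add ((hu.integrable_mul hφ2).norm.const_mul C))
      (fun n => Filter.Eventually.of_forall fun x => ?_)
      (Filter.Eventually.of_forall fun x => ?_)
    · exact hu.aestronglyMeasurable.mul (((hφ.mul (hχs n)).continuous_fderiv
        (by simp)).clm_apply continuous_const).aestronglyMeasurable
    · rw [hprod, mul_add]
      refine (norm_add_le _ _).trans (add_le_add ?_ ?_)
      · rw [← mul_assoc, norm_mul _ (χ n x)]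
        exact mul_le_of_le_one_right (norm_nonneg _) (hχ01 n x)
      · have : u x * (c n * (fderiv ℝ b (c n • x) e * φ x)) =
          (c n * fderiv ℝ b (c n • x) e) * (u x * φ x) := by ring
        rw [this, norm_mul]
        refine mul_le_mul_of_nonneg_right ?_ (norm_nonneg _)
        rw [norm_mul]
        exact (mul_le_mul (hc1 n) (hC _) (norm_nonneg _) zero_le_one).trans_eq (one_mul C)
    · simp only [hprod]
      have h0 : Filter.Tendsto (fun n => c n * (fderiv ℝ b (c n • x) e * φ x)) Filter.atTop
          (nhds 0) := by
        refine hc.zero_mul_isBoundedUnder_le ?_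
        refine Filter.isBoundedUnder_of ⟨C * ‖φ x‖, fun n => ?_⟩
        simp only [Function.comp_apply, norm_mul]
        exact mul_le_mul_of_nonneg_right (hC _) (norm_nonneg _)
      have := (((hχlim x).const_mul (fderiv ℝ φ x e)).add h0).const_mul (u x)
      simpa using this
  have hR : Filter.Tendsto (fun n => ∫ x, g x i * (φ x * χ n x)) Filter.atTop
      (nhds (∫ x, g x i * φ x)) := by
    refine tendsto_integral_of_dominated_convergence
      (fun x => ‖g x i * φ x‖) (fun n => ?_) (hgi.integrable_mul hφ2).norm
      (fun n => Filter.Eventually.of_forall fun x => ?_)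
      (Filter.Eventually.of_forall fun x => ?_)
    · exact hgi.aestronglyMeasurable.mul (hφ.mul (hχs n)).continuous.aestronglyMeasurable
    · rw [← mul_assoc, norm_mul _ (χ n x)]
      exact mul_le_of_le_one_right (norm_nonneg _) (hχ01 n x)
    · simpa using ((hχlim x).const_mul (φ x)).const_mul (g x i)
  have heq : ∀ n, ∫ x, u x * fderiv ℝ (fun x => φ x * χ n x) x e =
      - ∫ x, g x i * (φ x * χ n x) :=
    fun n => h.integral_eq _ (hφ.mul (hχs n)) ((hχc n).mul_left) i
  simp only [heq] at hL
  exact tendsto_nhds_unique hL hR.neg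

theorem memLp_fderiv_multiHermite (k : Fin N → ℕ) (i : Fin N) :
    MemLp (fun x => fderiv ℝ (multiHermite k) x (EuclideanSpace.single i 1)) 2 volume := by
  simp only [fderiv_multiHermite]
  convert ((memLp_multiHermite (k - Pi.single i 1)).const_mul (k i : ℝ)).sub
    ((memLp_multiHermite (k + Pi.single i 1)).const_mul (1 / 2)) using 1
  ext x; simp only [Pi.sub_apply]; ring

theorem add_single_injective (i : Fin N) :
    Function.Injective fun k : Fin N → ℕ => k + (Pi.single i 1 : Fin N → ℕ) := fun _ _ h => add_right_cancel h

theorem sub_single_add_single {m : Fin N → ℕ} {i : Fin N} (h : m i ≠ 0) :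
    m - Pi.single i 1 + Pi.single i 1 = m := by
  ext j
  rcases eq_or_ne j i with rfl | hj
  · simp; omega
  · simp [hj]

theorem hasSum_add_single_iff {f : (Fin N → ℕ) → ℝ} (i : Fin N) (hf : ∀ m, m i = 0 → f m = 0)
    {a : ℝ} : HasSum (fun k : Fin N → ℕ => f (k + Pi.single i 1)) a ↔ HasSum f a := by
  refine (add_single_injective i).hasSum_iff (f := f) fun m hm => hf m ?_
  by_contra h
  exact hm ⟨m - Pi.single i 1, sub_single_add_single h⟩

/-- The coefficients of `∂ᵢu` and `xᵢu` are `c(k+eᵢ)/2 ∓ kᵢ c(k-eᵢ)`. Adding the squares cancels the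
cross terms; with `b k = c(k)²/‖h_k‖²` there remains `(kᵢ+1) b(k+eᵢ) + kᵢ b(k-eᵢ)`, and shifting the
two sums gives `kᵢ b k + (kᵢ+1) b k`. -/
theorem hasSum_coord_energy {u : EuclideanSpace ℝ (Fin N) → ℝ}
    {g : EuclideanSpace ℝ (Fin N) → EuclideanSpace ℝ (Fin N)} (h : HasWeakGradient u g)
    (hu : MemLp u 2 volume) (hg : MemLp g 2 volume)
    (hxu : MemLp (fun x => u x • x) 2 volume) (i : Fin N) :
    HasSum (fun k : Fin N → ℕ => (2 * k i + 1 : ℝ) *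
      ((∫ x, u x * multiHermite k x) ^ 2 / multiHermiteNorm k))
      ((∫ x, g x i ^ 2) + ∫ x, (u x * x i) ^ 2) := by
  set c : (Fin N → ℕ) → ℝ := fun k => ∫ x, u x * multiHermite k x with hcdef
  have hgi : MemLp (fun x => g x i) 2 volume :=
    (EuclideanSpace.proj (𝕜 := ℝ) i).comp_memLp' hg
  have hxi : MemLp (fun x => u x * x i) 2 volume := by
    simpa using! (EuclideanSpace.proj (𝕜 := ℝ) i).comp_memLp' hxu
  have hi : ∀ k, Integrable fun x => u x * multiHermite k x :=
    fun k => hu.integrable_mul (memLp_multiHermite k)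
  have hgc : ∀ k, ∫ x, g x i * multiHermite k x =
      c (k + Pi.single i 1) / 2 - k i * c (k - Pi.single i 1) := by
    intro k
    have := h.integral_eq_of_memLp hu hg (contDiff_multiHermite k) (memLp_multiHermite k) i
      (memLp_fderiv_multiHermite k i)
    rw [← neg_eq_iff_eq_neg] at this
    rw [← this]
    simp only [fderiv_multiHermite, hcdef]
    rw [← integral_div, ← integral_const_mul, ← integral_neg,
      ← integral_sub ((hi _).div_const _) ((hi _).const_mul _)]
    congr 1; ext x; ring
  have hxc : ∀ k, ∫ x, (u x * x i) * multiHermite k x =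
      c (k + Pi.single i 1) / 2 + k i * c (k - Pi.single i 1) := by
    intro k
    simp only [hcdef, mul_assoc, mul_multiHermite]
    rw [← integral_div, ← integral_const_mul,
      ← integral_add ((hi _).div_const _) ((hi _).const_mul _)]
    congr 1; ext x; ring
  have hs := (hasSum_integral_multiHermite_sq hgi).add (hasSum_integral_multiHermite_sq hxi)
  simp only [hgc, hxc] at hs
  set b : (Fin N → ℕ) → ℝ := fun k => c k ^ 2 / multiHermiteNorm k with hbdef
  have hb0 : ∀ k, 0 ≤ b k := fun k => div_nonneg (sq_nonneg _) (multiHermiteNorm_pos k).le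
  let f₁ : (Fin N → ℕ) → ℝ := fun k => k i * b k
  let f₂ : (Fin N → ℕ) → ℝ := fun k => k i * b (k - Pi.single i 1)
  have hs' : HasSum (fun k => f₁ (k + Pi.single i 1) + f₂ k)
      ((∫ x, g x i ^ 2) + ∫ x, (u x * x i) ^ 2) := by
    refine hs.congr_fun fun k => ?_
    simp only [f₁, f₂, hbdef, multiHermiteNorm_add_single]
    have hp := (multiHermiteNorm_pos k).ne'
    have hk : (k i + 1 : ℝ) ≠ 0 := by positivity
    have e1 : c (k + Pi.single i 1) ^ 2 / (2 * (k i + 1) * multiHermiteNorm k) * (k i + 1) =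
      c (k + Pi.single i 1) ^ 2 / 2 / multiHermiteNorm k := by field_simp
    have e2 : (k i : ℝ) * (c (k - Pi.single i 1) ^ 2 / multiHermiteNorm (k - Pi.single i 1)) =
      2 * k i ^ 2 * c (k - Pi.single i 1) ^ 2 / multiHermiteNorm k := by
      by_cases h0 : k i = 0
      · simp [h0]
      · have := multiHermiteNorm_add_single (k - Pi.single i 1) i
        rw [sub_single_add_single h0] at this
        have hq : ((k - Pi.single i 1 : Fin N → ℕ) i : ℝ) + 1 = k i := by
          have : (k - Pi.single i 1 : Fin N → ℕ) i + 1 = k i := by simp; omega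
          exact_mod_cast this
        rw [hq] at this
        have hp' := (multiHermiteNorm_pos (k - Pi.single i 1)).ne'
        have h0' : (k i : ℝ) ≠ 0 := by exact_mod_cast h0
        rw [this]
        field_simp
    rw [e2]
    simp only [Pi.add_apply, Pi.single_eq_same, Nat.cast_add, Nat.cast_one]
    rw [mul_comm (k i + 1 : ℝ), e1]
    ring
  have hf₁ : ∀ k, 0 ≤ f₁ k := fun k => mul_nonneg (Nat.cast_nonneg _) (hb0 _)
  have hf₂ : ∀ k, 0 ≤ f₂ k := fun k => mul_nonneg (Nat.cast_nonneg _) (hb0 _)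
  -- The two parts are shifted in opposite directions, so each must be summable alone; nonnegativity
  -- provides this.
  have hs₁ : Summable fun k => f₁ (k + Pi.single i 1) :=
    hs'.summable.of_nonneg_of_le (fun k => hf₁ _) fun k => le_add_of_nonneg_right (hf₂ k)
  have hs₂ : Summable f₂ :=
    hs'.summable.of_nonneg_of_le hf₂ fun k => le_add_of_nonneg_left (hf₁ _)
  obtain ⟨a₁, ha₁⟩ := hs₁
  obtain ⟨a₂, ha₂⟩ := hs₂
  have ha := hs'.unique (ha₁.add ha₂)
  rw [hasSum_add_single_iff (f := f₁) i (fun m hm => by simp [f₁, hm])] at ha₁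
  rw [← hasSum_add_single_iff (f := f₂) i (fun m hm => by simp [f₂, hm])] at ha₂
  rw [ha]
  refine (ha₁.add ha₂).congr_fun fun k => ?_
  simp only [f₁, f₂, add_tsub_cancel_right, Pi.add_apply, Pi.single_eq_same]
  push_cast
  ring

theorem integral_norm_sq_eq_sum {g : EuclideanSpace ℝ (Fin N) → EuclideanSpace ℝ (Fin N)}
    (hg : MemLp g 2 volume) : ∫ x, ‖g x‖ ^ 2 = ∑ i, ∫ x, g x i ^ 2 := by
  simp only [EuclideanSpace.real_norm_sq_eq]
  exact integral_finsetSum _ fun i _ =>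
    ((EuclideanSpace.proj (𝕜 := ℝ) i).comp_memLp' hg).integrable_sq

theorem hasSum_energy {u : EuclideanSpace ℝ (Fin N) → ℝ}
    {g : EuclideanSpace ℝ (Fin N) → EuclideanSpace ℝ (Fin N)} (h : HasWeakGradient u g)
    (hu : MemLp u 2 volume) (hg : MemLp g 2 volume)
    (hxu : MemLp (fun x => u x • x) 2 volume) :
    HasSum (fun k : Fin N → ℕ => (2 * (∑ i, k i : ℕ) + N : ℝ) *
      ((∫ x, u x * multiHermite k x) ^ 2 / multiHermiteNorm k))
      ((∫ x, ‖g x‖ ^ 2) + ∫ x, ‖x‖ ^ 2 * u x ^ 2) := by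
  have h1 : ∫ x, ‖x‖ ^ 2 * u x ^ 2 = ∑ i, ∫ x, (u x * x i) ^ 2 := by
    have := integral_norm_sq_eq_sum hxu
    simp only [norm_smul, mul_pow, Real.norm_eq_abs, sq_abs, PiLp.smul_apply, smul_eq_mul] at this
    simpa only [mul_comm (‖_‖ ^ 2), mul_pow] using this
  rw [h1, integral_norm_sq_eq_sum hg, ← Finset.sum_add_distrib]
  refine (hasSum_sum fun i _ => hasSum_coord_energy h hu hg hxu i).congr_fun fun k => ?_
  rw [← Finset.sum_mul]
  congr 1
  rw [Finset.sum_add_distrib, ← Finset.mul_sum]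
  simp

/-- Spectral gap of the harmonic oscillator: the projection of `u` onto the Gaussian
`e^{-|x|²/2}` leaves a remainder controlled by the energy. -/
theorem energy_ge_projection {u : EuclideanSpace ℝ (Fin N) → ℝ}
    {g : EuclideanSpace ℝ (Fin N) → EuclideanSpace ℝ (Fin N)} (h : HasWeakGradient u g)
    (hu : MemLp u 2 volume) (hg : MemLp g 2 volume)
    (hxu : MemLp (fun x => u x • x) 2 volume) :
    N * (∫ x, u x ^ 2) + 2 * ((∫ x, u x ^ 2) -
      (∫ x, u x * multiHermite 0 x) ^ 2 / multiHermiteNorm (N := N) 0) ≤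
      (∫ x, ‖g x‖ ^ 2) + ∫ x, ‖x‖ ^ 2 * u x ^ 2 := by
  have hE := hasSum_energy h hu hg hxu
  have hM := hasSum_integral_multiHermite_sq hu
  have h0 := hasSum_ite_eq (0 : Fin N → ℕ)
    ((∫ x, u x * multiHermite 0 x) ^ 2 / multiHermiteNorm (N := N) 0)
  refine hasSum_le (fun k => ?_) ((hM.mul_left (N : ℝ)).add ((hM.sub h0).mul_left 2)) hE
  have hb : 0 ≤ (∫ x, u x * multiHermite k x) ^ 2 / multiHermiteNorm k :=
    div_nonneg (sq_nonneg _) (multiHermiteNorm_pos k).le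
  -- Termwise comparison: equality at `k = 0`, and eigenvalue at least `N + 2` elsewhere.
  split_ifs with hk
  · subst hk; simp
  · obtain ⟨j, hj⟩ := Function.ne_iff.1 hk
    have h1 : 1 ≤ ∑ i, k i := (Nat.one_le_iff_ne_zero.2 hj).trans
      (Finset.single_le_sum (f := k) (fun _ _ => Nat.zero_le _) (Finset.mem_univ j))
    have h2 : (1 : ℝ) ≤ (∑ i, k i : ℕ) := by exact_mod_cast h1
    nlinarith

end

/-! ### Dilations and projection onto Gaussians -/

section

variable {N : ℕ}

theorem MemLp.comp_const_smul {F : Type*} [NormedAddCommGroup F]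
    {f : EuclideanSpace ℝ (Fin N) → F} (hf : MemLp f 2 volume) {r : ℝ} (hr : r ≠ 0) :
    MemLp (fun x => f (r • x)) 2 volume := by
  have h : MemLp f 2 (Measure.map (r • ·) (volume : Measure (EuclideanSpace ℝ (Fin N)))) := by
    rw [Measure.map_addHaar_smul _ hr]
    exact hf.smul_measure ENNReal.ofReal_ne_top
  exact ((Homeomorph.smulOfNeZero r hr).measurableEmbedding.memLp_map_measure_iff).1 h

theorem integral_comp_const_smul (f : EuclideanSpace ℝ (Fin N) → ℝ) (r : ℝ) :
    ∫ x, f (r • x) = |(r ^ N)⁻¹| * ∫ x, f x := by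
  rw [Measure.integral_comp_smul]; simp

theorem HasWeakGradient.comp_const_smul {u : EuclideanSpace ℝ (Fin N) → ℝ}
    {g : EuclideanSpace ℝ (Fin N) → EuclideanSpace ℝ (Fin N)} (h : HasWeakGradient u g)
    (hu : MemLp u 2 volume) (hg : MemLp g 2 volume) {r : ℝ} (hr : r ≠ 0) :
    HasWeakGradient (fun x => u (r • x)) (fun x => r • g (r • x)) where
  locallyIntegrable := (MemLp.comp_const_smul hu hr).locallyIntegrable one_le_two
  locallyIntegrable_grad := ((MemLp.comp_const_smul hg hr).const_smul r).locallyIntegrable one_le_two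
  integral_eq φ hφ hc i := by
    have key := h.integral_eq (fun x => φ (r⁻¹ • x)) (hφ.comp (contDiff_const_smul r⁻¹))
      (hc.comp_smul (inv_ne_zero hr)) i
    have hd : ∀ x, fderiv ℝ (fun x => φ (r⁻¹ • x)) x (EuclideanSpace.single i 1) =
        r⁻¹ * fderiv ℝ φ (r⁻¹ • x) (EuclideanSpace.single i 1) := by
      intro x
      rw [fderiv_comp_smul]; simp
    simp only [hd] at key
    have hκ : |(r ^ N)⁻¹| ≠ 0 := abs_ne_zero.2 (inv_ne_zero (pow_ne_zero _ hr))
    have e1 := integral_comp_const_smul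
      (fun x => u x * (r⁻¹ * fderiv ℝ φ (r⁻¹ • x) (EuclideanSpace.single i 1))) r
    have e2 := integral_comp_const_smul (fun x => g x i * φ (r⁻¹ • x)) r
    simp only [smul_smul, inv_mul_cancel₀ hr, one_smul] at e1 e2
    rw [key, mul_neg, ← e2] at e1
    have e3 : ∀ x, u (r • x) * (r⁻¹ * fderiv ℝ φ x (EuclideanSpace.single i 1)) =
        r⁻¹ * (u (r • x) * fderiv ℝ φ x (EuclideanSpace.single i 1)) := fun x => by ring
    simp only [e3, integral_const_mul] at e1
    simp only [PiLp.smul_apply, smul_eq_mul, mul_assoc, integral_const_mul]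
    field_simp at e1
    linarith

theorem memLp_gaussian {α : ℝ} (hα : 0 < α) :
    MemLp (gaussianFn (N := N) 1 α) 2 volume := by
  have hc : Continuous (gaussianFn (N := N) 1 α) := by unfold gaussianFn; fun_prop
  rw [memLp_two_iff_integrable_sq hc.aestronglyMeasurable]
  have h := (GaussianFourier.integrable_cexp_neg_mul_sq_norm_add (b := ((2 * α : ℝ) : ℂ))
    (by simpa using hα) 0 (0 : EuclideanSpace ℝ (Fin N))).re
  refine h.congr (Filter.Eventually.of_forall fun x => ?_)
  have : (-((2 * α : ℝ) : ℂ) * (‖x‖ : ℂ) ^ 2 + 0 * (inner ℝ (0 : EuclideanSpace ℝ (Fin N)) x : ℝ)) =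
      ((-(2 * α) * ‖x‖ ^ 2 : ℝ) : ℂ) := by push_cast; ring
  simp only [gaussianFn]
  rw [this, ← Complex.ofReal_exp, one_mul, ← Real.exp_nat_mul]
  simp only [RCLike.re_to_complex, Complex.ofReal_re]
  congr 1; push_cast; ring

theorem gaussianFn_eq_mul (c α : ℝ) (x : EuclideanSpace ℝ (Fin N)) :
    gaussianFn c α x = c * gaussianFn 1 α x := by simp [gaussianFn]

theorem integral_gaussian_sq_pos {α : ℝ} (hα : 0 < α) :
    0 < ∫ x : EuclideanSpace ℝ (Fin N), gaussianFn 1 α x ^ 2 := by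
  have : ∀ x : EuclideanSpace ℝ (Fin N), gaussianFn 1 α x ^ 2 = Real.exp (-(2 * α) * ‖x‖ ^ 2) := by
    intro x
    simp only [gaussianFn]
    rw [one_mul, ← Real.exp_nat_mul]
    congr 1; push_cast; ring
  simp only [this]
  rw [GaussianFourier.integral_rexp_neg_mul_sq_norm (by positivity)]
  positivity

theorem integral_gaussianFn_sq (c α : ℝ) :
    ∫ x : EuclideanSpace ℝ (Fin N), gaussianFn c α x ^ 2 =
      c ^ 2 * ∫ x : EuclideanSpace ℝ (Fin N), gaussianFn 1 α x ^ 2 := by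
  simp only [gaussianFn_eq_mul c, mul_pow, integral_const_mul]

theorem integral_sub_gaussianFn_sq {u : EuclideanSpace ℝ (Fin N) → ℝ} (hu : MemLp u 2 volume)
    (c : ℝ) {α : ℝ} (hα : 0 < α) :
    ∫ x, (u x - gaussianFn c α x) ^ 2 = (∫ x, u x ^ 2) - 2 * c * (∫ x, u x * gaussianFn 1 α x) +
      c ^ 2 * ∫ x : EuclideanSpace ℝ (Fin N), gaussianFn 1 α x ^ 2 := by
  have h1 := hu.integrable_sq
  have h2 := (hu.integrable_mul (memLp_gaussian hα)).const_mul (2 * c)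
  have h3 := (memLp_gaussian (N := N) hα).integrable_sq.const_mul (c ^ 2)
  rw [← integral_const_mul, ← integral_const_mul]
  refine Eq.trans ?_ ((integral_add (h1.sub h2) h3).trans
    (congrArg₂ (· + ·) (integral_sub h1 h2) rfl))
  congr 1; ext x
  simp only [gaussianFn_eq_mul c, Pi.sub_apply, Pi.mul_apply]
  ring

/-- Spectral gap of the rescaled harmonic oscillator, with the projection onto its ground state. -/
theorem exists_gaussian_projection {u : EuclideanSpace ℝ (Fin N) → ℝ}
    {g : EuclideanSpace ℝ (Fin N) → EuclideanSpace ℝ (Fin N)} (h : HasWeakGradient u g)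
    (hu : MemLp u 2 volume) (hg : MemLp g 2 volume)
    (hxu : MemLp (fun x => u x • x) 2 volume) {r : ℝ} (hr : 0 < r) :
    ∃ c α : ℝ, 0 < α ∧
      (∫ x, u x * gaussianFn 1 α x) =
        c * ∫ x : EuclideanSpace ℝ (Fin N), gaussianFn 1 α x ^ 2 ∧
      N * (∫ x, u x ^ 2) + 2 * (∫ x, (u x - gaussianFn c α x) ^ 2) ≤
        r ^ 2 * (∫ x, ‖g x‖ ^ 2) + (r ^ 2)⁻¹ * ∫ x, ‖x‖ ^ 2 * u x ^ 2 := by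
  have hr' := hr.ne'
  have hxu' : MemLp (fun x => u (r • x) • x) 2 volume := by
    refine (memLp_congr_ae (Filter.Eventually.of_forall fun x => ?_)).1
      ((MemLp.comp_const_smul hxu hr').const_smul r⁻¹)
    simp only [Pi.smul_apply, smul_smul]
    congr 1; field_simp
  have key := energy_ge_projection (h.comp_const_smul hu hg hr') (MemLp.comp_const_smul hu hr')
    ((MemLp.comp_const_smul hg hr').const_smul r) hxu'
  -- The exponent for which `e^{-α|rx|²}` is the ground state `e^{-|x|²/2}`.
  set α : ℝ := 1 / (2 * r ^ 2) with hα
  have hα0 : 0 < α := by positivity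
  have hG : ∀ x : EuclideanSpace ℝ (Fin N), multiHermite 0 x = gaussianFn 1 α (r • x) := by
    intro x
    rw [multiHermite_zero, gaussianFn, one_mul, norm_smul, Real.norm_of_nonneg hr.le, hα]
    congr 1; field_simp
  -- The Jacobian of the dilation, common to all terms and cancelled at the end.
  set κ : ℝ := |(r ^ N)⁻¹| with hκ
  have hκ0 : 0 < κ := by positivity
  have eM : ∫ x, u (r • x) ^ 2 = κ * ∫ x, u x ^ 2 :=
    integral_comp_const_smul (fun x => u x ^ 2) r
  have eI : ∫ x, u (r • x) * multiHermite 0 x = κ * ∫ x, u x * gaussianFn 1 α x := by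
    simp only [hG]
    exact integral_comp_const_smul (fun x => u x * gaussianFn 1 α x) r
  have eG : multiHermiteNorm (N := N) 0 =
      κ * ∫ x : EuclideanSpace ℝ (Fin N), gaussianFn 1 α x ^ 2 := by
    rw [← integral_multiHermite_sq]
    simp only [hG]
    exact integral_comp_const_smul (fun x => gaussianFn 1 α x ^ 2) r
  have eA : ∫ x, ‖r • g (r • x)‖ ^ 2 = r ^ 2 * (κ * ∫ x, ‖g x‖ ^ 2) := by
    rw [← integral_comp_const_smul (fun x => ‖g x‖ ^ 2) r, ← integral_const_mul]
    simp only [norm_smul, mul_pow, Real.norm_eq_abs, sq_abs]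
  have eB : ∫ x, ‖x‖ ^ 2 * u (r • x) ^ 2 =
      (r ^ 2)⁻¹ * (κ * ∫ x, ‖x‖ ^ 2 * u x ^ 2) := by
    rw [← integral_comp_const_smul (fun x => ‖x‖ ^ 2 * u x ^ 2) r, ← integral_const_mul]
    congr 1; ext x
    simp only [norm_smul, mul_pow, Real.norm_eq_abs, sq_abs]
    field_simp
  rw [eM, eI, eG, eA, eB] at key
  have hΓ := integral_gaussian_sq_pos (N := N) hα0
  refine ⟨(∫ x, u x * gaussianFn 1 α x) / ∫ x : EuclideanSpace ℝ (Fin N), gaussianFn 1 α x ^ 2,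
    α, hα0, (div_mul_cancel₀ _ hΓ.ne').symm, ?_⟩
  rw [integral_sub_gaussianFn_sq hu _ hα0]
  generalize (∫ x : EuclideanSpace ℝ (Fin N), gaussianFn 1 α x ^ 2) = Γ at *
  generalize (∫ x, u x * gaussianFn 1 α x) = I at *
  generalize (∫ x, u x ^ 2) = M at *
  generalize (∫ x, ‖g x‖ ^ 2) = A at *
  generalize (∫ x, ‖x‖ ^ 2 * u x ^ 2) = B at *
  refine le_of_mul_le_mul_left ?_ hκ0
  calc κ * (N * M + 2 * (M - 2 * (I / Γ) * I + (I / Γ) ^ 2 * Γ))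
      = N * (κ * M) + 2 * (κ * M - (κ * I) ^ 2 / (κ * Γ)) := by field_simp; ring
    _ ≤ _ := key
    _ = _ := by ring

/-! ### The two stability estimates -/

theorem hasWeakGradient_weakGradient {u : EuclideanSpace ℝ (Fin N) → ℝ}
    {g : EuclideanSpace ℝ (Fin N) → EuclideanSpace ℝ (Fin N)} (h : HasWeakGradient u g) :
    HasWeakGradient u (weakGradient u) := by
  have hex : ∃ g, HasWeakGradient u g := ⟨g, h⟩
  rw [weakGradient, dif_pos hex]
  exact hex.choose_spec

theorem integral_norm_weakGradient_sq {u : EuclideanSpace ℝ (Fin N) → ℝ}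
    {g : EuclideanSpace ℝ (Fin N) → EuclideanSpace ℝ (Fin N)} (h : HasWeakGradient u g) :
    ∫ x, ‖weakGradient u x‖ ^ 2 = ∫ x, ‖g x‖ ^ 2 :=
  integral_congr_ae (((hasWeakGradient_weakGradient h).ae_eq h).mono fun x hx => by
    simp only [hx])

/-- The deficit controls the distance to the projection onto some Gaussian direction. -/
theorem exists_gaussian_projection_le_deficit (hN : 0 < N) {u : EuclideanSpace ℝ (Fin N) → ℝ}
    (hu : u ∈ heisenbergSpace N) :
    ∃ c α : ℝ, 0 < α ∧
      (∫ x, u x * gaussianFn 1 α x) =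
        c * ∫ x : EuclideanSpace ℝ (Fin N), gaussianFn 1 α x ^ 2 ∧
      ∫ x, (u x - gaussianFn c α x) ^ 2 ≤ heisenbergDeficit u := by
  obtain ⟨⟨hu2, g, hg, hg2⟩, hxu⟩ := hu
  have gap := fun (r : ℝ) (hr : 0 < r) => exists_gaussian_projection hg hu2 hg2 hxu hr
  rw [heisenbergDeficit, integral_norm_weakGradient_sq hg]
  have hA : 0 ≤ ∫ x, ‖g x‖ ^ 2 := integral_nonneg fun _ => by positivity
  have hB : 0 ≤ ∫ x, ‖x‖ ^ 2 * u x ^ 2 := integral_nonneg fun _ => by positivity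
  have hM : 0 ≤ ∫ x, u x ^ 2 := integral_nonneg fun _ => by positivity
  have hN1 : (1 : ℝ) ≤ N := by exact_mod_cast hN
  generalize hAdef : (∫ x, ‖g x‖ ^ 2) = A at *
  generalize hBdef : (∫ x, ‖x‖ ^ 2 * u x ^ 2) = B at *
  generalize hMdef : (∫ x, u x ^ 2) = M at *
  have bound : ∀ r : ℝ, 0 < r → M ≤ r ^ 2 * A + (r ^ 2)⁻¹ * B := by
    intro r hr
    obtain ⟨c, α, -, -, hle⟩ := gap r hr
    have : 0 ≤ ∫ x, (u x - gaussianFn c α x) ^ 2 := integral_nonneg fun _ => by positivity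
    nlinarith
  -- If `A` or `B` vanishes, no `r` balances the two terms. In that case extreme dilations force `M
  -- = 0`.
  by_cases hAB : A = 0 ∨ B = 0
  · have hM0 : M = 0 := by
      by_contra hne
      have hMpos : 0 < M := lt_of_le_of_ne hM (Ne.symm hne)
      rcases hAB with h0 | h0
      -- This `r` gives `M ≤ M B / (B + 1) < M`; the one in the other case gives `M ≤ M A / (A + 1)
      -- < M`.
      · have hb := bound (√((B + 1) / M)) (by positivity)
        rw [Real.sq_sqrt (by positivity), h0, mul_zero, zero_add, inv_div, div_mul_eq_mul_div,
          le_div_iff₀ (by positivity)] at hb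
        nlinarith
      · have hb := bound (√(M / (A + 1))) (by positivity)
        rw [Real.sq_sqrt (by positivity), h0, mul_zero, add_zero, div_mul_eq_mul_div,
          le_div_iff₀ (by positivity)] at hb
        nlinarith
    obtain ⟨c, α, hα, hI, -⟩ := gap 1 one_pos
    refine ⟨c, α, hα, hI, ?_⟩
    have hδ : √A * √B - N / 2 * M = 0 := by
      rcases hAB with h0 | h0 <;> simp [h0, hM0]
    rw [hδ, integral_sub_gaussianFn_sq hu2 c hα, hI, hMdef, hM0]
    have := integral_gaussian_sq_pos (N := N) hα
    nlinarith [sq_nonneg c]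
  · push Not at hAB
    have hA' : 0 < A := lt_of_le_of_ne hA (Ne.symm hAB.1)
    have hB' : 0 < B := lt_of_le_of_ne hB (Ne.symm hAB.2)
    have ha := Real.sqrt_pos.2 hA'
    have hb := Real.sqrt_pos.2 hB'
    -- The minimiser of `r²A + r⁻²B`, with minimum `2√A√B`.
    obtain ⟨c, α, hα, hI, hle⟩ := gap (√(√B / √A)) (by positivity)
    refine ⟨c, α, hα, hI, ?_⟩
    rw [Real.sq_sqrt (by positivity)] at hle
    have e : √B / √A * A + (√B / √A)⁻¹ * B = 2 * (√A * √B) := by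
      have h1 := Real.sq_sqrt hA
      have h2 := Real.sq_sqrt hB
      field_simp
      rw [h1, h2]; ring
    rw [e] at hle
    linarith

theorem gaussianDistSq_le {u : EuclideanSpace ℝ (Fin N) → ℝ} {c α : ℝ} (hα : 0 < α) :
    gaussianDistSq u ≤ ∫ x, (u x - gaussianFn c α x) ^ 2 :=
  csInf_le ⟨0, by rintro _ ⟨c, α, -, rfl⟩; exact integral_nonneg fun _ => by positivity⟩
    ⟨c, α, hα, rfl⟩

theorem gaussianDistSqSameNorm_le {u : EuclideanSpace ℝ (Fin N) → ℝ} {c α : ℝ} (hα : 0 < α)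
    (hn : ∫ x, u x ^ 2 = ∫ x : EuclideanSpace ℝ (Fin N), gaussianFn c α x ^ 2) :
    gaussianDistSqSameNorm u ≤ ∫ x, (u x - gaussianFn c α x) ^ 2 :=
  csInf_le ⟨0, by rintro _ ⟨c, α, -, -, rfl⟩; exact integral_nonneg fun _ => by positivity⟩
    ⟨c, α, hα, hn, rfl⟩

theorem heisenbergDeficit_ge_gaussianDistSq (hN : 0 < N) {u : EuclideanSpace ℝ (Fin N) → ℝ}
    (hu : u ∈ heisenbergSpace N) : gaussianDistSq u ≤ heisenbergDeficit u := by
  obtain ⟨c, α, hα, -, hle⟩ := exists_gaussian_projection_le_deficit hN hu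
  exact (gaussianDistSq_le hα).trans hle

/-- Let `cG` be the projection and `sG`, `s ≥ 0`, have the norm of `u`. Taking the sign of `c`, the
squared distance is `2(M - |c|sΓ)`, at most `2(M - c²Γ)` because `|c| ≤ s`; and `M - c²Γ` is the
squared distance to the projection. -/
theorem heisenbergDeficit_ge_gaussianDistSqSameNorm (hN : 0 < N)
    {u : EuclideanSpace ℝ (Fin N) → ℝ} (hu : u ∈ heisenbergSpace N) :
    1 / 2 * gaussianDistSqSameNorm u ≤ heisenbergDeficit u := by
  obtain ⟨c, α, hα, hI, hle⟩ := exists_gaussian_projection_le_deficit hN hu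
  have hu2 := hu.1.1
  have hΓ := integral_gaussian_sq_pos (N := N) hα
  have hM : 0 ≤ ∫ x, u x ^ 2 := integral_nonneg fun _ => by positivity
  have hd : 0 ≤ ∫ x, (u x - gaussianFn c α x) ^ 2 := integral_nonneg fun _ => by positivity
  -- A sign that is nonzero also for `c = 0`, so that `σ * s` always has the prescribed norm.
  obtain ⟨σ, hσ, hσc⟩ : ∃ σ : ℝ, σ ^ 2 = 1 ∧ σ * c = |c| := by
    rcases abs_cases c with h | h
    · exact ⟨1, by norm_num, by rw [h.1, one_mul]⟩
    · exact ⟨-1, by norm_num, by rw [h.1]; ring⟩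
  set Γ := ∫ x : EuclideanSpace ℝ (Fin N), gaussianFn 1 α x ^ 2 with hΓdef
  set s : ℝ := √((∫ x, u x ^ 2) / Γ) with hs
  have hs2 : s ^ 2 * Γ = ∫ x, u x ^ 2 := by
    rw [hs, Real.sq_sqrt (by positivity), div_mul_cancel₀ _ hΓ.ne']
  have hn : ∫ x, u x ^ 2 = ∫ x : EuclideanSpace ℝ (Fin N), gaussianFn (σ * s) α x ^ 2 := by
    rw [integral_gaussianFn_sq, ← hΓdef, mul_pow, hσ, one_mul, hs2]
  refine (mul_le_mul_of_nonneg_left (gaussianDistSqSameNorm_le hα hn) (by norm_num)).trans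
    (le_trans ?_ hle)
  rw [integral_sub_gaussianFn_sq hu2 _ hα, hI, ← hΓdef] at hd hle ⊢
  rw [integral_sub_gaussianFn_sq hu2 _ hα, hI, ← hΓdef]
  -- Bessel's inequality `c²Γ ≤ M`, which is the nonnegativity `hd`.
  have hcs : |c| ≤ s := by
    rw [hs]
    refine Real.abs_le_sqrt ?_
    rw [le_div_iff₀ hΓ]
    nlinarith
  have h1 : |c| * |c| ≤ |c| * s := mul_le_mul_of_nonneg_left hcs (abs_nonneg c)
  have h2 : |c| * |c| = c ^ 2 := by rw [abs_mul_abs_self, pow_two]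
  have h3 : c ^ 2 * Γ ≤ |c| * s * Γ := mul_le_mul_of_nonneg_right (h2 ▸ h1) hΓ.le
  have h4 : 2 * (σ * s) * (c * Γ) = 2 * (|c| * s * Γ) := by rw [← hσc]; ring
  have h5 : (σ * s) ^ 2 * Γ = ∫ x, u x ^ 2 := by rw [mul_pow, hσ, one_mul, hs2]
  rw [h4, h5]
  nlinarith

end

/-! ### Sharpness: the function `xᵢ e^{-|x|²/2}` -/

section

variable {N : ℕ}

/-- The classical gradient of a smooth function is its weak gradient. -/
theorem hasWeakGradient_of_contDiff {f : EuclideanSpace ℝ (Fin N) → ℝ} (hf : ContDiff ℝ ∞ f) :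
    HasWeakGradient f
      (fun x => WithLp.toLp 2 fun i => fderiv ℝ f x (EuclideanSpace.single i 1)) where
  locallyIntegrable := hf.continuous.locallyIntegrable
  locallyIntegrable_grad := by
    refine Continuous.locallyIntegrable ?_
    exact (PiLp.continuous_toLp 2 _).comp (continuous_pi fun i =>
      (hf.continuous_fderiv (by simp)).clm_apply continuous_const)
  integral_eq φ hφ hc i := by
    have hf' : Continuous fun x => fderiv ℝ f x (EuclideanSpace.single i 1) :=
      (hf.continuous_fderiv (by simp)).clm_apply continuous_const
    have hφ' : Continuous fun x => fderiv ℝ φ x (EuclideanSpace.single i 1) :=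
      (hφ.continuous_fderiv (by simp)).clm_apply continuous_const
    exact integral_mul_fderiv_eq_neg_fderiv_mul_of_integrable
      ((hf'.mul hφ.continuous).integrable_of_hasCompactSupport hc.mul_left)
      ((hf.continuous.mul hφ').integrable_of_hasCompactSupport (hc.fderiv_apply ℝ _).mul_left)
      ((hf.continuous.mul hφ.continuous).integrable_of_hasCompactSupport hc.mul_left)
      (fun x _ => hf.differentiable (by simp) x) (fun x _ => hφ.differentiable (by simp) x)

theorem integral_multiHermite_combination_sq {k l : Fin N → ℕ} (h : k ≠ l) (a b : ℝ) :
    ∫ x, (a * multiHermite k x + b * multiHermite l x) ^ 2 =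
      a ^ 2 * multiHermiteNorm k + b ^ 2 * multiHermiteNorm l := by
  have h1 := (memLp_multiHermite k).integrable_sq.const_mul (a ^ 2)
  have h2 := (memLp_multiHermite l).integrable_sq.const_mul (b ^ 2)
  have h3 := ((memLp_multiHermite k).integrable_mul (memLp_multiHermite l)).const_mul (2 * a * b)
  have e3 := integral_multiHermite_mul k l
  rw [if_neg h] at e3
  rw [← integral_multiHermite_sq k, ← integral_multiHermite_sq l, ← integral_const_mul,
    ← integral_const_mul]
  have h3' : ∫ x, 2 * a * b * (multiHermite k * multiHermite l) x = 0 := by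
    rw [integral_const_mul]
    simp only [Pi.mul_apply, e3, mul_zero]
  refine Eq.trans ?_ ((integral_add (h1.add h2) h3).trans
    ((congrArg₂ (· + ·) (integral_add h1 h2) h3').trans (add_zero _)))
  congr 1; ext x
  simp only [Pi.add_apply, Pi.mul_apply]
  ring

/-- The sign `s = 1` gives `xᵢ h_k` and `s = -1` gives `∂ᵢh_k`. The two summands are orthogonal, so
both have the same norm: position and momentum share the energy of `h_k` equally. -/
theorem integral_ladder_sq (k : Fin N → ℕ) (i : Fin N) {s : ℝ} (hs : s ^ 2 = 1) :
    ∫ x, (k i * multiHermite (k - Pi.single i 1) x +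
      s * (1 / 2) * multiHermite (k + Pi.single i 1) x) ^ 2 =
      (k i + 1 / 2) * multiHermiteNorm k := by
  have hne : k - Pi.single i 1 ≠ k + Pi.single i 1 := by
    intro h
    have := congrFun h i
    simp at this
  rw [integral_multiHermite_combination_sq hne, mul_pow, hs, multiHermiteNorm_add_single]
  by_cases h0 : k i = 0
  · rw [h0]; push_cast; ring
  · have := multiHermiteNorm_add_single (k - Pi.single i 1) i
    rw [sub_single_add_single h0] at this
    have hq : ((k - Pi.single i 1 : Fin N → ℕ) i : ℝ) + 1 = k i := by
      have : (k - Pi.single i 1 : Fin N → ℕ) i + 1 = k i := by simp; omega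
      exact_mod_cast this
    rw [hq] at this
    rw [this]; ring

theorem hermiteGaussian_eq (i : Fin N) (x : EuclideanSpace ℝ (Fin N)) :
    hermiteGaussian i x = 1 / 2 * multiHermite (Pi.single i 1) x := by
  have := mul_multiHermite 0 i x
  simp only [zero_add, Pi.zero_apply, Nat.cast_zero, zero_mul, add_zero] at this
  rw [hermiteGaussian, ← multiHermite_zero, this]; ring

theorem contDiff_hermiteGaussian (i : Fin N) : ContDiff ℝ ∞ (hermiteGaussian i) := by
  rw [show hermiteGaussian i = fun x => 1 / 2 * multiHermite (Pi.single i 1) x from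
    funext (hermiteGaussian_eq i)]
  exact contDiff_const.mul (contDiff_multiHermite _)

theorem memLp_hermiteGaussian (i : Fin N) : MemLp (hermiteGaussian i) 2 volume := by
  rw [show hermiteGaussian i = fun x => 1 / 2 * multiHermite (Pi.single i 1) x from
    funext (hermiteGaussian_eq i)]
  exact (memLp_multiHermite _).const_mul _

theorem fderiv_hermiteGaussian (i j : Fin N) (x : EuclideanSpace ℝ (Fin N)) :
    fderiv ℝ (hermiteGaussian i) x (EuclideanSpace.single j 1) =
      1 / 2 * fderiv ℝ (multiHermite (Pi.single i 1)) x (EuclideanSpace.single j 1) := by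
  rw [show hermiteGaussian i = fun x => 1 / 2 * multiHermite (Pi.single i 1) x from
    funext (hermiteGaussian_eq i), fderiv_const_mul
      ((contDiff_multiHermite _).differentiable (by simp) x)]
  simp

theorem memLp_gradient_hermiteGaussian (i : Fin N) :
    MemLp (fun x => WithLp.toLp 2 fun j =>
      fderiv ℝ (hermiteGaussian i) x (EuclideanSpace.single j 1)) 2 volume := by
  refine MemLp.of_eval_piLp fun j => ?_
  simp only [fderiv_hermiteGaussian]
  exact (memLp_fderiv_multiHermite _ j).const_mul _

theorem memLp_mul_multiHermite (k : Fin N → ℕ) (i : Fin N) :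
    MemLp (fun x : EuclideanSpace ℝ (Fin N) => x i * multiHermite k x) 2 volume :=
  memLp_of_mem_hermiteSpan (coord_mul_mem_hermiteSpan (Submodule.subset_span ⟨k, rfl⟩) i)

theorem memLp_hermiteGaussian_smul (i : Fin N) :
    MemLp (fun x => hermiteGaussian i x • x) 2 volume := by
  refine MemLp.of_eval_piLp fun j => ?_
  refine (memLp_congr_ae (Filter.Eventually.of_forall fun x => ?_)).1
    ((memLp_mul_multiHermite (Pi.single i 1) j).const_mul (1 / 2))
  simp only [PiLp.smul_apply, smul_eq_mul, hermiteGaussian_eq]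
  ring

theorem hermiteGaussian_mem_heisenbergSpace (i : Fin N) :
    hermiteGaussian i ∈ heisenbergSpace N :=
  ⟨⟨memLp_hermiteGaussian i, _, hasWeakGradient_of_contDiff (contDiff_hermiteGaussian i),
    memLp_gradient_hermiteGaussian i⟩, memLp_hermiteGaussian_smul i⟩

theorem integral_hermiteGaussian_sq (i : Fin N) :
    ∫ x, hermiteGaussian i x ^ 2 = 1 / 4 * multiHermiteNorm (Pi.single i 1) := by
  simp only [hermiteGaussian_eq, mul_pow]
  rw [integral_const_mul, integral_multiHermite_sq]
  norm_num

theorem sum_single_add_half (i : Fin N) :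
    ∑ j, (((Pi.single i 1 : Fin N → ℕ) j : ℝ) + 1 / 2) = 1 + N / 2 := by
  have h : ∑ j, (Pi.single i 1 : Fin N → ℕ) j = 1 := by simp
  rw [Finset.sum_add_distrib, ← Nat.cast_sum, h]
  simp
  ring

theorem integral_gradient_hermiteGaussian_sq (i : Fin N) :
    ∫ x, ‖weakGradient (hermiteGaussian i) x‖ ^ 2 =
      (1 + N / 2) * ∫ x, hermiteGaussian i x ^ 2 := by
  rw [integral_norm_weakGradient_sq (hasWeakGradient_of_contDiff (contDiff_hermiteGaussian i)),
    integral_norm_sq_eq_sum (memLp_gradient_hermiteGaussian i), integral_hermiteGaussian_sq,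
    ← sum_single_add_half i, Finset.sum_mul]
  refine Finset.sum_congr rfl fun j _ => ?_
  have h := integral_ladder_sq (Pi.single i 1) j (s := -1) (by norm_num)
  simp only [fderiv_hermiteGaussian, mul_pow (1 / 2 : ℝ), integral_const_mul]
  rw [mul_left_comm, ← h]
  congr 1
  · norm_num
  · congr 1; ext x
    rw [fderiv_multiHermite]; ring

theorem integral_norm_sq_mul_hermiteGaussian_sq (i : Fin N) :
    ∫ x, ‖x‖ ^ 2 * hermiteGaussian i x ^ 2 =
      (1 + N / 2) * ∫ x, hermiteGaussian i x ^ 2 := by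
  have e : ∫ x, ‖x‖ ^ 2 * hermiteGaussian i x ^ 2 = ∫ x, ‖hermiteGaussian i x • x‖ ^ 2 := by
    congr 1; ext x
    rw [norm_smul, mul_pow, Real.norm_eq_abs, sq_abs, mul_comm]
  rw [e, integral_norm_sq_eq_sum (memLp_hermiteGaussian_smul i), integral_hermiteGaussian_sq,
    ← sum_single_add_half i, Finset.sum_mul]
  refine Finset.sum_congr rfl fun j _ => ?_
  have h := integral_ladder_sq (Pi.single i 1) j (s := 1) (by norm_num)
  have e : ∀ x : EuclideanSpace ℝ (Fin N), (hermiteGaussian i x • x) j =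
      1 / 2 * (x j * multiHermite (Pi.single i 1) x) := fun x => by
    simp only [PiLp.smul_apply, smul_eq_mul, hermiteGaussian_eq]; ring
  simp only [e, mul_pow (1 / 2 : ℝ), integral_const_mul]
  rw [mul_left_comm, ← h]
  congr 1
  · norm_num
  · congr 1; ext x
    rw [mul_multiHermite]; ring

/-- Both energies equal `(1 + N/2)‖u‖²`, so the square roots multiply without loss and `N/2`
cancels. -/
theorem heisenbergDeficit_hermiteGaussian (i : Fin N) :
    heisenbergDeficit (hermiteGaussian i) = ∫ x, hermiteGaussian i x ^ 2 := by
  rw [heisenbergDeficit, integral_gradient_hermiteGaussian_sq,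
    integral_norm_sq_mul_hermiteGaussian_sq, Real.mul_self_sqrt]
  · ring
  · exact mul_nonneg (by positivity) (integral_nonneg fun _ => by positivity)

/-- The integrand is odd. -/
theorem integral_hermiteGaussian_mul_gaussianFn (i : Fin N) (α : ℝ) :
    ∫ x, hermiteGaussian i x * gaussianFn 1 α x = 0 := by
  have h := integral_neg_eq_self (fun x => hermiteGaussian i x * gaussianFn 1 α x) volume
  have e : ∀ x : EuclideanSpace ℝ (Fin N), hermiteGaussian i (-x) * gaussianFn 1 α (-x) =
      -(hermiteGaussian i x * gaussianFn 1 α x) := fun x => by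
    simp [hermiteGaussian, gaussianFn]
  simp only [e, integral_neg] at h
  linarith

theorem integral_hermiteGaussian_sub_gaussianFn_sq (i : Fin N) (c : ℝ) {α : ℝ} (hα : 0 < α) :
    ∫ x, (hermiteGaussian i x - gaussianFn c α x) ^ 2 =
      (∫ x, hermiteGaussian i x ^ 2) +
        ∫ x : EuclideanSpace ℝ (Fin N), gaussianFn c α x ^ 2 := by
  rw [integral_sub_gaussianFn_sq (memLp_hermiteGaussian i) c hα,
    integral_hermiteGaussian_mul_gaussianFn, integral_gaussianFn_sq c]
  ring

theorem integral_hermiteGaussian_sq_pos (i : Fin N) : 0 < ∫ x, hermiteGaussian i x ^ 2 := by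
  rw [integral_hermiteGaussian_sq]
  exact mul_pos (by norm_num) (multiHermiteNorm_pos _)

theorem gaussianDistSq_hermiteGaussian (i : Fin N) :
    gaussianDistSq (hermiteGaussian i) = ∫ x, hermiteGaussian i x ^ 2 := by
  refine le_antisymm ?_ (le_csInf ⟨_, 0, 1, one_pos, rfl⟩ ?_)
  -- By orthogonality the best competitor is the zero function, admitted through `c = 0`.
  · simpa [gaussianFn] using gaussianDistSq_le (u := hermiteGaussian i) (c := 0) one_pos
  · rintro _ ⟨c, α, hα, rfl⟩
    rw [integral_hermiteGaussian_sub_gaussianFn_sq i c hα]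
    exact le_add_of_nonneg_right (integral_nonneg fun _ => by positivity)

theorem gaussianDistSqSameNorm_hermiteGaussian (i : Fin N) :
    gaussianDistSqSameNorm (hermiteGaussian i) = 2 * ∫ x, hermiteGaussian i x ^ 2 := by
  -- By Pythagoras every admissible Gaussian is at the same distance, so it remains only to exhibit
  -- one.
  have hv : ∀ c α : ℝ, 0 < α →
      ∫ x, hermiteGaussian i x ^ 2 = ∫ x : EuclideanSpace ℝ (Fin N), gaussianFn c α x ^ 2 →
      ∫ x, (hermiteGaussian i x - gaussianFn c α x) ^ 2 = 2 * ∫ x, hermiteGaussian i x ^ 2 := by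
    intro c α hα hn
    rw [integral_hermiteGaussian_sub_gaussianFn_sq i c hα, ← hn]; ring
  have hΓ := integral_gaussian_sq_pos (N := N) one_pos
  have hu := integral_hermiteGaussian_sq_pos i
  have hn : ∫ x, hermiteGaussian i x ^ 2 = ∫ x : EuclideanSpace ℝ (Fin N), gaussianFn
      (√((∫ x, hermiteGaussian i x ^ 2) /
        ∫ x : EuclideanSpace ℝ (Fin N), gaussianFn 1 1 x ^ 2)) 1 x ^ 2 := by
    rw [integral_gaussianFn_sq, Real.sq_sqrt (by positivity), div_mul_cancel₀ _ hΓ.ne']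
  refine le_antisymm ?_ (le_csInf ⟨_, _, 1, one_pos, hn, rfl⟩ ?_)
  · exact (gaussianDistSqSameNorm_le one_pos hn).trans_eq (hv _ _ one_pos hn)
  · rintro _ ⟨c, α, hα, hn, rfl⟩
    exact (hv c α hα hn).ge

end

/-- Sharp stability of the Heisenberg uncertainty principle on `ℝ^N`, `N ≥ 1`: the two stability
estimates; equality in both, with a positive distance, for `x₁ e^{-|x|²/2}`; and the optimality of
the constants `1` and `1/2`. -/
theorem theorem1p2 (N : ℕ) (hN : 0 < N) :
    (∀ u ∈ heisenbergSpace N, heisenbergDeficit u ≥ gaussianDistSq u) ∧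
    (∀ u ∈ heisenbergSpace N, heisenbergDeficit u ≥ 1 / 2 * gaussianDistSqSameNorm u) ∧
    (hermiteGaussian (⟨0, hN⟩ : Fin N) ∈ heisenbergSpace N ∧
      0 < gaussianDistSq (hermiteGaussian (⟨0, hN⟩ : Fin N)) ∧
      heisenbergDeficit (hermiteGaussian (⟨0, hN⟩ : Fin N)) =
        gaussianDistSq (hermiteGaussian (⟨0, hN⟩ : Fin N)) ∧
      0 < gaussianDistSqSameNorm (hermiteGaussian (⟨0, hN⟩ : Fin N)) ∧
      heisenbergDeficit (hermiteGaussian (⟨0, hN⟩ : Fin N)) =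
        1 / 2 * gaussianDistSqSameNorm (hermiteGaussian (⟨0, hN⟩ : Fin N))) ∧
    (∀ C : ℝ, (∀ u ∈ heisenbergSpace N, heisenbergDeficit u ≥ C * gaussianDistSq u) → C ≤ 1) ∧
    (∀ C : ℝ, (∀ u ∈ heisenbergSpace N,
      heisenbergDeficit u ≥ C * gaussianDistSqSameNorm u) → C ≤ 1 / 2) := by
  have hmem := hermiteGaussian_mem_heisenbergSpace (⟨0, hN⟩ : Fin N)
  have hpos := integral_hermiteGaussian_sq_pos (⟨0, hN⟩ : Fin N)
  have hδ := heisenbergDeficit_hermiteGaussian (⟨0, hN⟩ : Fin N)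
  have hd := gaussianDistSq_hermiteGaussian (⟨0, hN⟩ : Fin N)
  have hs := gaussianDistSqSameNorm_hermiteGaussian (⟨0, hN⟩ : Fin N)
  refine ⟨fun u hu => heisenbergDeficit_ge_gaussianDistSq hN hu,
    fun u hu => heisenbergDeficit_ge_gaussianDistSqSameNorm hN hu,
    ⟨hmem, by rwa [hd], by rw [hδ, hd], by rw [hs]; linarith, by rw [hδ, hs]; ring⟩,
    fun C hC => ?_, fun C hC => ?_⟩
  · have h := hC _ hmem
    rw [hδ, hd] at h
    exact le_of_mul_le_mul_right (by linarith) hpos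
  · have h := hC _ hmem
    rw [hδ, hs] at h
    exact le_of_mul_le_mul_right (by linarith) hpos
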